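/- Let $L$ be a first-order language containing the language of valued fields (the language of rings together with a unary predicate for the valuation ring), and let $T$ be an $L$-theory all of whose models are valued fields $(K,v)$, possibly with additional structure. Write $Kv$ for the residue field and $vK$ for the value group; both are quotients of $\emptyset$-definable subsets of $K$ and are regarded as (imaginary) sorts. A partitioned formula $\varphi(x;y)$ is NIP modulo a theory if for some $n$ there are, in no model of the theory, tuples $a_i$ ($i<n$) and $b_S$ ($S\subseteq\{0,\dots,n-1\}$) such that $\varphi(a_i;b_S)$ holds if and only if $i\in S$. A theory is NIP if all partitioned formulas are NIP modulo it. A sort $D$ is stably embedded in a model $K$ of $T$ if for every formula $\varphi(x;y)$, $y$ a finite tuple of variables of the sort $D$, there is a formula $d\varphi(z;y)$, $z$ a finite tuple of variables of the sort $D$, such that for every $a\in K^{|x|}$ there is a tuple $b\in D^{|z|}$ with $\varphi(a;D)=d\varphi(b;D)$. Assume that $T$ satisfies the following two conditions. (SE) In every model $(K,v)$ of $T$, the residue field $Kv$ and the value group $vK$ are stably embedded. (Im) Whenever $K\preceq U$ are models of $T$ and $a\in U$ is a single element of the field such that the extension $K(a)/K$ of valued fields (with the valuations restricted from $U$) is immediate,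 i.e. has the same value group and the same residue field, the type $\mathrm{tp}(a/K)$ is implied by instances of NIP formulas: every formula in $\mathrm{tp}(a/K)$ is implied in $U$ by a finite conjunction of formulas $\varphi(x;b)\in\mathrm{tp}(a/K)$, where $b$ is a tuple from $K$ and $\varphi(x;y)$ is NIP modulo $\mathrm{Th}(U)$. Then $T$ is NIP if and only if, for every model $(K,v)$ of $T$, the theory of the residue field $Kv$ and the theory of the value group $vK$ are NIP, where $Kv$ and $vK$ carry the structure induced from $K$, whose relations are all subsets of $(Kv)^n$, respectively $(vK)^n$, that are definable in $K$ without parameters. -/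

import Mathlib

open FirstOrder FirstOrder.Language

universe u v w w'

namespace NIPTransfer

/-! ### NIP formulas and theories -/

section NIP

variable {L : FirstOrder.Language.{u, v}}

/-- The partitioned formula `φ(x; y)` shatters a family of `n` tuples in `M`: there are
`a₀, …, aₙ₋₁` and `b_S` for `S ⊆ {0, …, n - 1}` such that `M ⊨ φ(aᵢ; b_S)` iff `i ∈ S`. -/
def Shatters {p q : ℕ} (φ : L.Formula (Fin p ⊕ Fin q)) (M : Type w) [L.Structure M]
    (n : ℕ) : Prop :=
  ∃ (a : Fin n → Fin p → M) (b : Set (Fin n) → Fin q → M),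
    ∀ (i : Fin n) (S : Set (Fin n)), φ.Realize (Sum.elim (a i) (b S)) ↔ i ∈ S

/-- `φ(x; y)` is NIP modulo `T`: for some `n`, it does not shatter `n` tuples in any model of
`T`. -/
def IsNIPFormula (T : L.Theory) {p q : ℕ} (φ : L.Formula (Fin p ⊕ Fin q)) : Prop :=
  ∃ n : ℕ, ∀ (M : Type (max u v)) [L.Structure M] [Nonempty M] [T.Model M],
    ¬ Shatters φ M n

/-- A theory is NIP if every partitioned formula is NIP modulo the theory. -/
def IsNIPTheory (T : L.Theory) : Prop :=
  ∀ (p q : ℕ) (φ : L.Formula (Fin p ⊕ Fin q)), IsNIPFormula T φ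

end NIP

/-! ### Interpretable sorts: stable embeddedness and induced structure

A sort `D` of a structure `M` is presented by a surjection `π : X → D` from a subset `X` of `M`
(below: the valuation ring onto the residue field, and the nonzero elements onto the value group).
-/

section Sorts

variable {L : FirstOrder.Language.{u, v}} {M : Type w} [L.Structure M] {D : Type w'} {X : Set M}

/-- The subset of `D^β` defined by the formula `ψ`: the image under `π` of the set of tuples
of elements of `X` satisfying `ψ`. -/
def inducedRel (π : X → D) {β : Type} (ψ : L.Formula β) : Set (β → D) :=
  {d | ∃ y : β → X, (∀ j, π (y j) = d j) ∧ ψ.Realize fun j => (y j : M)}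

/-- The subset `φ(a; D)` of `D^n`, where `a` is a tuple of elements of `M`. -/
def traceOn (π : X → D) {p n : ℕ} (φ : L.Formula (Fin p ⊕ Fin n)) (a : Fin p → M) :
    Set (Fin n → D) :=
  {d | ∃ y : Fin n → X, (∀ j, π (y j) = d j) ∧ φ.Realize (Sum.elim a fun j => (y j : M))}

variable (L) in
/-- `D` is stably embedded: for every `φ(x; y)`, `y` a tuple of variables of the sort `D`, there
is a formula `dφ(z; y)` such that for every tuple `a` there is a tuple `b` of elements of `D` with
`φ(a; D) = dφ(b; D)`. -/
def IsStablyEmbedded (π : X → D) : Prop :=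
  ∀ (p n : ℕ) (φ : L.Formula (Fin p ⊕ Fin n)),
    ∃ (q : ℕ) (ψ : L.Formula (Fin q ⊕ Fin n)),
      ∀ a : Fin p → M, ∃ b : Fin q → D,
        traceOn π φ a = {d : Fin n → D | Sum.elim b d ∈ inducedRel π ψ}

/-- The language of the induced structure: an `n`-ary relation symbol for every `L`-formula in
`n` variables. -/
def inducedLanguage (L : FirstOrder.Language.{u, v}) : FirstOrder.Language.{0, max u v} :=
  ⟨fun _ => Empty, fun n => L.Formula (Fin n)⟩

variable (L) in
/-- The structure induced on `D`: the relations are all the subsets of `D^n` that are definable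
without parameters. -/
@[reducible] def inducedStructure (π : X → D) : (inducedLanguage L).Structure D where
  funMap := fun f _ => Empty.elim f
  RelMap := fun {n} (ψ : L.Formula (Fin n)) d => d ∈ inducedRel π ψ

variable (L) in
/-- The complete theory of `D` with its induced structure. -/
def inducedTheory (π : X → D) : (inducedLanguage L).Theory :=
  letI := inducedStructure L π
  (inducedLanguage L).completeTheory D

end Sorts

/-! ### Valued fields -/

section ValuedFields

/-- The presentation of the residue field. -/
noncomputable def residueMap {K : Type w} [Field K] (A : ValuationSubring K) :
    ((A : Set K) : Type w) → IsLocalRing.ResidueField A :=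
  fun x => IsLocalRing.residue A ⟨x.1, x.2⟩

/-- The presentation of the value group (without the value of `0`). -/
noncomputable def valueMap {K : Type w} [Field K] (A : ValuationSubring K) :
    ({x : K | x ≠ 0} : Set K) → (A.ValueGroup)ˣ :=
  fun x => Units.mk0 (A.valuation x.1) ((Valuation.ne_zero_iff _).2 x.2)

/-- The values of the elements of the subfield `F`. -/
def valuesOf {K : Type w} [Field K] (A : ValuationSubring K) (F : Subfield K) :
    Set A.ValueGroup :=
  {g | ∃ x ∈ F, A.valuation x = g}

/-- The residue field of the subfield `F`, as a subset of the residue field of `K`. -/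
def residuesOf {K : Type w} [Field K] (A : ValuationSubring K) (F : Subfield K) :
    Set (IsLocalRing.ResidueField A) :=
  {r | ∃ x : A, (x : K) ∈ F ∧ IsLocalRing.residue A x = r}

/-- For the restrictions to `F` and `E` of the valuation of `K`, the extension `E / F` is
immediate: it changes neither the value group nor the residue field. -/
def IsImmediate {K : Type w} [Field K] (A : ValuationSubring K) (F E : Subfield K) : Prop :=
  F ≤ E ∧ valuesOf A E = valuesOf A F ∧ residuesOf A E = residuesOf A F

/-- A language containing the language of valued fields: the language of rings together with a
unary predicate for the valuation ring. -/
structure ValuedFieldLanguage (L : FirstOrder.Language.{u, v}) where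
  ring : FirstOrder.Language.ring →ᴸ L
  valRing : L.Relations 1

/-- In the `L`-structure `K`, the symbols of the language of valued fields are interpreted by
the field operations of `K` and by the valuation ring `A`. -/
structure IsValuedField {L : FirstOrder.Language.{u, v}} (σ : ValuedFieldLanguage L) (K : Type w)
    [L.Structure K] [Field K] (A : ValuationSubring K) : Prop where
  add : ∀ x y : K, Structure.funMap (σ.ring.onFunction Ring.addFunc) ![x, y] = x + y
  mul : ∀ x y : K, Structure.funMap (σ.ring.onFunction Ring.mulFunc) ![x, y] = x * y
  neg : ∀ x : K, Structure.funMap (σ.ring.onFunction Ring.negFunc) ![x] = -x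
  zero : Structure.funMap (σ.ring.onFunction Ring.zeroFunc) ![] = (0 : K)
  one : Structure.funMap (σ.ring.onFunction Ring.oneFunc) ![] = (1 : K)
  mem : ∀ x : K, Structure.RelMap σ.valRing ![x] ↔ x ∈ A

variable {L : FirstOrder.Language.{u, v}}

/-- `T` is a theory of valued fields, possibly with additional structure. The field structure
and the valuation ring of a model are uniquely determined by its `L`-structure. -/
def IsValuedFieldTheory (σ : ValuedFieldLanguage L) (T : L.Theory) : Prop :=
  ∀ (K : Type (max u v)) [L.Structure K] [Nonempty K] [T.Model K],
    ∃ (_ : Field K) (A : ValuationSubring K), IsValuedField σ K A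

/-- The residue field and the value group are stably embedded. -/
def CondSE (σ : ValuedFieldLanguage L) (T : L.Theory) : Prop :=
  ∀ (K : Type (max u v)) [L.Structure K] [T.Model K] [Field K] (A : ValuationSubring K),
    IsValuedField σ K A →
      IsStablyEmbedded L (residueMap A) ∧ IsStablyEmbedded L (valueMap A)

/-- An instance `φ(x; b)`, `x` a single variable, of a partitioned formula `φ(x; y)`, with
parameters `b` from `K`. -/
structure FormulaInstance (L : FirstOrder.Language.{u, v}) {U : Type w} (K : Set U) where
  arity : ℕ
  formula : L.Formula (Fin 1 ⊕ Fin arity)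
  param : Fin arity → K

/-- `U ⊨ φ(a; b)`. -/
def FormulaInstance.Holds {U : Type w} [L.Structure U] {K : Set U} (χ : FormulaInstance L K)
    (a : U) : Prop :=
  χ.formula.Realize (Sum.elim (fun _ => a) fun j => (χ.param j : U))

/-- The type of `a` over `K`. -/
def typeOver (L : FirstOrder.Language.{u, v}) {U : Type w} [L.Structure U] (K : Set U) (a : U) :
    Set (FormulaInstance L K) :=
  {χ | χ.Holds a}

/-- The partial type `P` over `K` implies the partial type `Q`: every member of `Q` is implied
in `U` by a finite conjunction of members of `P`. -/
def Implies {U : Type w} [L.Structure U] {K : Set U} (P Q : Set (FormulaInstance L K)) : Prop :=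
  ∀ ψ ∈ Q, ∃ P₀ ⊆ P, P₀.Finite ∧ ∀ x : U, (∀ χ ∈ P₀, χ.Holds x) → ψ.Holds x

/-- For `K ≼ U ⊨ T` and an element `a` of `U` such that `K(a) / K` is immediate, `tp(a / K)` is
implied by the instances of NIP formulas that it contains. -/
def CondIm (σ : ValuedFieldLanguage L) (T : L.Theory) : Prop :=
  ∀ (U : Type (max u v)) [L.Structure U] [T.Model U] [Field U] (A : ValuationSubring U),
    IsValuedField σ U A →
      ∀ (K : L.ElementarySubstructure U) (a : U),
        IsImmediate A (Subfield.closure (K : Set U)) (Subfield.closure (insert a (K : Set U))) →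
          Implies
            {χ ∈ typeOver L (K : Set U) a | IsNIPFormula (L.completeTheory U) χ.formula}
            (typeOver L (K : Set U) a)

/-- The theories of the residue fields of the models of `T`, with the induced structure, are
NIP. -/
def ResidueFieldNIP (σ : ValuedFieldLanguage L) (T : L.Theory) : Prop :=
  ∀ (K : Type (max u v)) [L.Structure K] [T.Model K] [Field K] (A : ValuationSubring K),
    IsValuedField σ K A → IsNIPTheory (inducedTheory L (residueMap A))

/-- The theories of the value groups of the models of `T`, with the induced structure, are
NIP. -/
def ValueGroupNIP (σ : ValuedFieldLanguage L) (T : L.Theory) : Prop :=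
  ∀ (K : Type (max u v)) [L.Structure K] [T.Model K] [Field K] (A : ValuationSubring K),
    IsValuedField σ K A → IsNIPTheory (inducedTheory L (valueMap A))

end ValuedFields

end NIPTransfer

/-! Suppose that the residue fields and the value groups are NIP but that some formula is not. An
ultraproduct gives one model M in which this formula shatters arbitrarily large families, and the
formula may then be replaced by some φ(x; y) with a single variable x
(`not_patterns_of_single_variable`). The goal is a structure U ≡ M, some K ≼ U and elements a, a' of
U such that K(a)/K is immediate, φ(a; c) and ¬φ(a'; c) hold for a tuple c from K, and a, a' satisfy
the same instances over K of NIP formulas. This contradicts (Im): tp(a/K) follows from its NIP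
instances, a' satisfies them, hence φ(a'; c).

Instead of indiscernible sequences the proof uses finite patterns: parameters c₀, …, cₙ₋₁ such that
for every set T of indices some a is in relation P to the cⱼ with j ∈ T and in relation Q to the
others. The key lemma is `Patterns.attach`: data z that depend on a and on cⱼ may be made part of
the parameter on the P side, provided that the relations "the pattern T with data z is realised" do
not shatter large families. Its proof combines Ramsey's theorem with an alternating sequence. It is
applied to the first coordinate of a tuple (reduction to a single variable), to truth values of
finitely many NIP formulas (`Patterns.exists_agree`), and to elements of the residue field and the
value group definable from a and c (`Patterns.lift`). In the last case stable embeddedness and NIP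
of the sort bound the shattering.

The parameter c is thus enlarged to a family indexed by `WitnessVar`, with witnesses for existential
formulas and lifts of all residues and values definable from c and a. By compactness all these
conditions hold at once. The family then enumerates an elementary substructure K, and K(a)/K is
immediate because elements of K(a) are definable from c and a.

Conversely, formulas of the induced structure translate into L-formulas on representatives, so
shattering in a sort gives shattering in K. -/

namespace NIPTransfer

/-! ### Ramsey's theorem -/

section Ramsey

open Filter

variable {C : Type*} [Finite C]

/-- A function to a finite type is almost everywhere constant with respect to an ultrafilter. -/
theorem exists_eventually_eq_const {ι : Type*} (U : Ultrafilter ι) (f : ι → C) :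
    ∃ c, ∀ᶠ x in U, f x = c := by
  obtain ⟨c, hc⟩ := Ultrafilter.eq_pure_of_finite (U.map f)
  refine ⟨c, ?_⟩
  have : {c} ∈ U.map f := by rw [hc]; exact Ultrafilter.mem_pure.2 rfl
  exact this

/-- The iterated limits of a colouring of finite sets along a nonprincipal ultrafilter. -/
noncomputable def limColouring (f : Finset ℕ → C) : ℕ → Finset ℕ → C
  | 0 => f
  | k + 1 => fun s =>
    (exists_eventually_eq_const (hyperfilter ℕ) fun x => limColouring f k (insert x s)).choose

theorem limColouring_spec (f : Finset ℕ → C) (k : ℕ) (s : Finset ℕ) :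
    ∀ᶠ x in (hyperfilter ℕ : Filter ℕ),
      limColouring f k (insert x s) = limColouring f (k + 1) s :=
  (exists_eventually_eq_const (hyperfilter ℕ) fun x => limColouring f k (insert x s)).choose_spec

/-- Only finitely many pairs (s, k) occur, so almost every x reaches its limit colour for all of
them; since the ultrafilter is nonprincipal, almost every x also exceeds S. -/
theorem exists_next (f : Finset ℕ → C) (r : ℕ) (S : Finset ℕ) :
    ∃ x, (∀ y ∈ S, y < x) ∧
      ∀ s ∈ S.powerset, ∀ k ∈ Finset.range r,
        limColouring f k (insert x s) = limColouring f (k + 1) s := by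
  have h1 : ∀ᶠ x in (hyperfilter ℕ : Filter ℕ), ∀ y ∈ S, y < x := by
    rw [eventually_all_finset]
    intro y _
    have : ∀ᶠ x in (atTop : Filter ℕ), y < x := eventually_gt_atTop y
    exact (Nat.hyperfilter_le_atTop) this
  have h2 : ∀ᶠ x in (hyperfilter ℕ : Filter ℕ), ∀ s ∈ S.powerset, ∀ k ∈ Finset.range r,
        limColouring f k (insert x s) = limColouring f (k + 1) s := by
    rw [eventually_all_finset]
    intro s _
    rw [eventually_all_finset]
    exact fun k _ => limColouring_spec f k s
  exact (h1.and h2).exists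

/-- The infinite Ramsey theorem for finite sets. -/
theorem exists_strictMono_image_const (f : Finset ℕ → C) (r : ℕ) :
    ∃ g : ℕ → ℕ, StrictMono g ∧ ∃ c, ∀ s : Finset ℕ, s.card = r → f (s.image g) = c := by
  choose next hnext using exists_next f r
  let S : ℕ → Finset ℕ := fun n => Nat.rec ∅ (fun _ S => insert (next S) S) n
  have hS : ∀ n, S (n + 1) = insert (next (S n)) (S n) := fun n => rfl
  let g : ℕ → ℕ := fun n => next (S n)
  have hmem : ∀ m n, m < n → g m ∈ S n := by
    intro m n h
    induction n with
    | zero => omega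
    | succ n ih =>
      rw [hS]
      rcases Nat.lt_succ_iff_lt_or_eq.1 h with h | rfl
      · exact Finset.mem_insert_of_mem (ih h)
      · exact Finset.mem_insert_self _ _
  have hg : StrictMono g := fun m n h => (hnext (S n)).1 _ (hmem m n h)
  refine ⟨g, hg, limColouring f r ∅, ?_⟩
  -- Removing the largest index raises the level of the limit by one, so the colour of an r-set
  -- equals the r-fold limit at ∅.
  have key : ∀ j ≤ r, ∀ s : Finset ℕ, s.card = j →
      limColouring f (r - j) (s.image g) = limColouring f r ∅ := by
    intro j
    induction j with
    | zero =>
      intro _ s hs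
      rw [Finset.card_eq_zero.1 hs]; simp
    | succ j ih =>
      intro hj s hs
      have hne : s.Nonempty := by rw [← Finset.card_pos]; omega
      have hmx := s.max'_mem hne
      set x := s.max' hne with hx
      have hcard : (s.erase x).card = j := by rw [Finset.card_erase_of_mem hmx, hs]; rfl
      rw [← ih (by omega) _ hcard, ← Finset.insert_erase hmx, Finset.image_insert]
      have hsub : (s.erase x).image g ∈ (S x).powerset := by
        rw [Finset.mem_powerset]
        intro y hy
        obtain ⟨z, hz, rfl⟩ := Finset.mem_image.1 hy
        refine hmem _ _ (lt_of_le_of_ne (s.le_max' z (Finset.mem_of_mem_erase hz)) ?_)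
        exact Finset.ne_of_mem_erase hz
      have h := (hnext (S x)).2 _ hsub (r - (j + 1)) (Finset.mem_range.2 (by omega))
      have hr : r - (j + 1) + 1 = r - j := by omega
      rw [hr] at h
      rw [Finset.erase_insert_eq_erase, Finset.erase_idem]
      exact h
  intro s hs
  have := key r le_rfl s hs
  rwa [Nat.sub_self] at this

/-- The infinite Ramsey theorem for increasing tuples. -/
theorem exists_strictMono_homogeneous (r : ℕ) (f : (Fin r → ℕ) → C) :
    ∃ g : ℕ → ℕ, StrictMono g ∧ ∀ h h' : Fin r → ℕ, StrictMono h → StrictMono h' →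
      f (g ∘ h) = f (g ∘ h') := by
  classical
  let F : Finset ℕ → C := fun s =>
    if hs : s.card = r then f (s.orderEmbOfFin hs) else f 0
  obtain ⟨g, hg, c, hc⟩ := exists_strictMono_image_const F r
  have key : ∀ h : Fin r → ℕ, StrictMono h → f (g ∘ h) = c := by
    intro h hh
    have hcard : (Finset.univ.image h).card = r := by
      rw [Finset.card_image_of_injective _ hh.injective]; simp
    rw [← hc _ hcard]
    have hcard' : ((Finset.univ.image h).image g).card = r := by
      rw [Finset.card_image_of_injective _ hg.injective, hcard]
    simp only [F, dif_pos hcard']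
    congr 1
    refine Finset.orderEmbOfFin_unique hcard' (fun x => ?_) (hg.comp hh)
    exact Finset.mem_image_of_mem _ (Finset.mem_image_of_mem _ (Finset.mem_univ _))
  exact ⟨g, hg, fun h h' hh hh' => (key h hh).trans (key h' hh').symm⟩

/-- The finite Ramsey theorem for increasing tuples. -/
theorem exists_bound_homogeneous (C : Type*) [Finite C] (r n : ℕ) :
    ∃ N : ℕ, ∀ f : (Fin r → ℕ) → C, ∃ g : ℕ → ℕ, StrictMono g ∧ (∀ i < n, g i < N) ∧
      ∀ h h' : Fin r → ℕ, StrictMono h → StrictMono h' → (∀ i, h i < n) → (∀ i, h' i < n) →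
        f (g ∘ h) = f (g ∘ h') := by
  by_contra! hcon
  choose f hf using hcon
  -- The counterexamples for the various N have a limit colouring F. A homogeneous sequence for F is
  -- one for some counterexample too, as only the finitely many tuples from its first n terms
  -- matter.
  choose F hF using fun t : Fin r → ℕ =>
    exists_eventually_eq_const (hyperfilter ℕ) fun N => f N t
  obtain ⟨g, hg, hom⟩ := exists_strictMono_homogeneous r F
  have h1 : ∀ᶠ N in (hyperfilter ℕ : Filter ℕ), g n < N :=
    Nat.hyperfilter_le_atTop (eventually_gt_atTop (g n))
  have h2 : ∀ᶠ N in (hyperfilter ℕ : Filter ℕ), ∀ t : Fin r → Fin n,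
      f N (fun i => g (t i)) = F fun i => g (t i) :=
    eventually_all.2 fun t => hF _
  obtain ⟨N, hN1, hN2⟩ := (h1.and h2).exists
  obtain ⟨h, h', hh, hh', hb, hb', hne⟩ := hf N g hg fun i hi => (hg hi).trans hN1
  refine hne ?_
  have e1 := hN2 fun i => ⟨h i, hb i⟩
  have e2 := hN2 fun i => ⟨h' i, hb' i⟩
  exact (e1.trans (hom h h' hh hh')).trans e2.symm

end Ramsey

/-! ### Shattering and patterns -/

section Patterns

variable {X Y Z A B : Type*}

/-- The relation `R` shatters a family of `n` elements of `A`. -/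
def RelShatters (R : A → B → Prop) (n : ℕ) : Prop :=
  ∃ (a : Fin n → A) (b : Set (Fin n) → B), ∀ i S, R (a i) (b S) ↔ i ∈ S

theorem RelShatters.mono {R : A → B → Prop} {m n : ℕ} (h : RelShatters R n) (hmn : m ≤ n) :
    RelShatters R m := by
  obtain ⟨a, b, hab⟩ := h
  refine ⟨a ∘ Fin.castLE hmn, fun S => b (Fin.castLE hmn '' S), fun i S => ?_⟩
  rw [Function.comp_apply, hab]
  exact (Fin.castLE_injective hmn).mem_set_image

/-- Index the shattered points by the subsets of `Fin n`; for each i some parameter cuts out exactly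
the subsets that contain i. -/
theorem RelShatters.swap {R : A → B → Prop} {n N : ℕ} (h : RelShatters R N)
    (hN : Nat.card (Set (Fin n)) ≤ N) : RelShatters (fun b a => R a b) n := by
  have e := Finite.equivFin (Set (Fin n))
  obtain ⟨a, b, hab⟩ := h.mono hN
  refine ⟨fun i => b {j | i ∈ e.symm j}, fun S => a (e S), fun i S => ?_⟩
  exact (hab _ _).trans (by simp)

/-- Finite patterns of all kinds are realised: for every `n` there are `c₀, …, cₙ₋₁` such that for
every set `T` of indices some `a` is in relation `P` to the `cⱼ`, `j ∈ T`, and in relation `Q` to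
the others. -/
def Patterns (P Q : X → Y → Prop) : Prop :=
  ∀ n : ℕ, ∃ c : Fin n → Y, ∀ T : Set (Fin n), ∃ a : X,
    ∀ j, (j ∈ T → P a (c j)) ∧ (j ∉ T → Q a (c j))

theorem Patterns.symm {P Q : X → Y → Prop} (h : Patterns P Q) : Patterns Q P := by
  intro n
  obtain ⟨c, hc⟩ := h n
  refine ⟨c, fun T => ?_⟩
  obtain ⟨a, ha⟩ := hc Tᶜ
  exact ⟨a, fun j => ⟨fun hj => (ha j).2 fun h => h hj, fun hj => (ha j).1 hj⟩⟩

theorem Patterns.map {X' Y' : Type*} {P Q : X → Y → Prop} {P' Q' : X' → Y' → Prop}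
    (h : Patterns P Q) (f : X → X') (g : Y → Y') (hP : ∀ a c, P a c → P' (f a) (g c))
    (hQ : ∀ a c, Q a c → Q' (f a) (g c)) : Patterns P' Q' := by
  intro n
  obtain ⟨c, hc⟩ := h n
  refine ⟨g ∘ c, fun T => ?_⟩
  obtain ⟨a, ha⟩ := hc T
  exact ⟨f a, fun j => ⟨fun hj => hP _ _ ((ha j).1 hj), fun hj => hQ _ _ ((ha j).2 hj)⟩⟩

theorem Patterns.of_relShatters {R : A → B → Prop} (h : ∀ n, RelShatters R n) :
    Patterns (fun b a => R a b) (fun b a => ¬ R a b) := by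
  intro n
  obtain ⟨a, b, hab⟩ := h n
  exact ⟨a, fun T => ⟨b T, fun j => ⟨(hab j T).2, fun hj h => hj ((hab j T).1 h)⟩⟩⟩

theorem Patterns.relShatters {R : X → Y → Prop} (h : Patterns R (fun a c => ¬ R a c)) (n : ℕ) :
    RelShatters (fun c a => R a c) n := by
  obtain ⟨c, hc⟩ := h n
  choose a ha using hc
  exact ⟨c, a, fun i S => ⟨fun h => by_contra fun hi => (ha S i).2 hi h, (ha S i).1⟩⟩

theorem Patterns.exists_seq {P Q : X → Y → Prop} (h : Patterns P Q) (N : ℕ) :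
    ∃ c : ℕ → Y, ∀ T : Set ℕ, ∃ a : X,
      ∀ j < N, (j ∈ T → P a (c j)) ∧ (j ∉ T → Q a (c j)) := by
  -- This only supplies an element of Y with which to pad the sequence from N on.
  obtain ⟨c1, -⟩ := h 1
  obtain ⟨c, hc⟩ := h N
  refine ⟨fun j => if hj : j < N then c ⟨j, hj⟩ else c1 0, fun T => ?_⟩
  obtain ⟨a, ha⟩ := hc {j | (j : ℕ) ∈ T}
  refine ⟨a, fun j hj => ?_⟩
  simpa [hj] using ha ⟨j, hj⟩

/-- A colouring with finitely many colours may be assumed to be constant. -/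
theorem Patterns.exists_colour {P Q : X → Y → Prop} (h : Patterns P Q) {C : Type*} [Finite C]
    (f : Y → C) :
    ∃ k, Patterns (fun a c => P a c ∧ f c = k) fun a c => Q a c ∧ f c = k := by
  classical
  by_contra! hcon
  have hcon' : ∀ k, ∃ n, ¬ ∃ c : Fin n → Y, ∀ T : Set (Fin n), ∃ a : X,
    ∀ j, (j ∈ T → P a (c j) ∧ f (c j) = k) ∧ (j ∉ T → Q a (c j) ∧ f (c j) = k) :=
    fun k => not_forall.1 (hcon k)
  choose n hn using hcon'
  have := Fintype.ofFinite C
  -- Pigeonhole: some colour k occurs at least m ≥ n k times, which contradicts the failure of k at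
  -- length n k. The extra index below makes C nonempty.
  let m := ∑ k, n k
  obtain ⟨c, hc⟩ := h (Fintype.card C * m + 1)
  have : Nonempty C := ⟨f (c 0)⟩
  obtain ⟨k, hk⟩ := Fintype.exists_le_card_fiber_of_mul_le_card (fun j => f (c j)) (n := m)
    (by simp)
  have hk' : Fintype.card (Fin (n k)) ≤ Fintype.card {j // f (c j) = k} := by
    rw [Fintype.card_fin, Fintype.card_subtype]
    exact (Finset.single_le_sum (f := n) (fun _ _ => Nat.zero_le _) (Finset.mem_univ k)).trans hk
  obtain ⟨e⟩ := Function.Embedding.nonempty_of_card_le hk'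
  refine hn k ⟨fun i => c (e i), fun T => ?_⟩
  obtain ⟨a, ha⟩ := hc {j | ∃ i ∈ T, (e i : Fin _) = j}
  refine ⟨a, fun i => ⟨fun hi => ⟨(ha _).1 ⟨i, hi, rfl⟩, (e i).2⟩,
    fun hi => ⟨(ha _).2 ?_, (e i).2⟩⟩⟩
  rintro ⟨i', hi', h'⟩
  rw [e.injective (Subtype.ext h')] at hi'
  exact hi hi'

/-- The relation between tuples `y` and `z` that expresses that the pattern given by `T` is
realised by some `a` that is, moreover, in relation `G` to `yⱼ` and `zⱼ` for `j ∈ T`. -/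
def patternRel (P Q : X → Y → Prop) (G : X → Y → Z → Prop) {n : ℕ} (T : Set (Fin n))
    (y : Fin n → Y) (z : Fin n → Z) : Prop :=
  ∃ a, ∀ j, (j ∈ T → P a (y j) ∧ G a (y j) (z j)) ∧ (j ∉ T → Q a (y j))

theorem patternRel_congr {P Q : X → Y → Prop} {G : X → Y → Z → Prop} {n : ℕ} {T : Set (Fin n)}
    {y : Fin n → Y} {z z' : Fin n → Z} (h : ∀ j ∈ T, z j = z' j) :
    patternRel P Q G T y z ↔ patternRel P Q G T y z' := by
  refine exists_congr fun a => forall_congr' fun j => and_congr_left fun _ => ?_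
  exact forall_congr' fun hj => by rw [h j hj]

/-- If the pattern relations do not shatter large families, values `z` with `G a y z` may be
attached to the elements `y` in relation `P` to `a`. -/
theorem Patterns.attach {P Q : X → Y → Prop} {G : X → Y → Z → Prop} (hPQ : Patterns P Q)
    (hG : ∀ a y, ∃ z, G a y z)
    (hVC : ∀ (n : ℕ) (T : Set (Fin n)), ∃ m, ¬ RelShatters
      (fun (y : Fin n → Y) (z : {z : Fin n → Z //
          ∃ (a : X) (y : Fin n → Y), ∀ j, G a (y j) (z j)}) =>
        patternRel P Q G T y z) m) :
    Patterns (fun a (p : Y × Z) => P a p.1 ∧ G a p.1 p.2) fun a p => Q a p.1 := by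
  classical
  intro n
  obtain ⟨m, hm0, hm⟩ : ∃ m, 0 < m ∧ ∀ T : Set (Fin n), ¬ RelShatters
      (fun (y : Fin n → Y) (z : {z : Fin n → Z //
          ∃ (a : X) (y : Fin n → Y), ∀ j, G a (y j) (z j)}) =>
        patternRel P Q G T y z) m := by
    choose m hm using hVC n
    have := Fintype.ofFinite (Set (Fin n))
    refine ⟨∑ T, m T + 1, Nat.succ_pos _, fun T hT => hm T (hT.mono ?_)⟩
    exact (Finset.single_le_sum (f := m) (fun _ _ => Nat.zero_le _) (Finset.mem_univ T)).trans
      (Nat.le_succ _)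
  let B := {z : Fin n → Z // ∃ (a : X) (y : Fin n → Y), ∀ j, G a (y j) (z j)}
  -- There are n consecutive blocks of m places. Choosing one place from each block gives an
  -- increasing n-tuple, whichever places are chosen.
  let pos : Fin n → Fin m → Fin (n * m) := fun j l => finProdFinEquiv (j, l)
  obtain ⟨N₂, hN₂⟩ := exists_bound_homogeneous (Set (Fin n) × (Fin n → Bool) → Prop) n (n * m)
  obtain ⟨N₁, hN₁⟩ := exists_bound_homogeneous
    (Set (Fin n) × Fin n × Set (Fin m) → Prop) (n * m) (2 * N₂)
  obtain ⟨c₀, hc₀⟩ := hPQ.exists_seq N₁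
  -- After this choice, whether some z realises a given η ⊆ `Fin m` along block k does not depend on
  -- the increasing array of parameters used.
  obtain ⟨g₁, hg₁, hg₁N, hom₁⟩ := hN₁ fun t p => ∃ z : B, ∀ l,
    patternRel P Q G p.1 (fun j => c₀ (t (pos j (if j = p.2.1 then l else ⟨0, hm0⟩)))) z.1 ↔
      l ∈ p.2.2
  let c : ℕ → Y := fun i => c₀ (g₁ i)
  -- One element alternates along the sequence: P at even places, Q at odd ones.
  obtain ⟨a, ha⟩ : ∃ a, ∀ i < N₂, P a (c (2 * i)) ∧ Q a (c (2 * i + 1)) := by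
    obtain ⟨a, ha⟩ := hc₀ {x | ∃ i, g₁ (2 * i) = x}
    refine ⟨a, fun i hi => ⟨(ha _ (hg₁N _ (by omega))).1 ⟨i, rfl⟩,
      (ha _ (hg₁N _ (by omega))).2 ?_⟩⟩
    rintro ⟨i', h'⟩
    have := hg₁.injective h'
    omega
  choose e he using fun i => hG a (c (2 * i))
  -- With the values e fixed by a, the pattern relation for prescribed parities is now the same for
  -- all increasing choices of places.
  obtain ⟨g₂, hg₂, hg₂N, hom₂⟩ := hN₂ fun t p =>
    patternRel P Q G p.1 (fun j => c (2 * t j + (p.2 j).toNat)) fun j => e (t j)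
  have hbase : StrictMono fun j : Fin n => (pos j ⟨0, hm0⟩ : ℕ) := by
    intro j j' hj
    have : (j : ℕ) < j' := hj
    simp only [pos, finProdFinEquiv_apply_val]
    nlinarith
  -- Indices in T ∪ V stand at even places, the others at odd ones. For V = ∅ the alternating
  -- element a is a witness; for V = Tᶜ the parameters no longer depend on T and form the desired
  -- pattern.
  have key : ∀ (T : Set (Fin n)) (V : Finset (Fin n)), Disjoint T (V : Set (Fin n)) →
      patternRel P Q G T
        (fun j => c (2 * g₂ (pos j ⟨0, hm0⟩) +
          (decide (j ∉ T ∧ j ∉ V)).toNat)) (fun j => e (g₂ (pos j ⟨0, hm0⟩))) := by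
    intro T V
    induction V using Finset.induction_on with
    | empty =>
      intro _
      refine ⟨a, fun j => ⟨fun hj => ?_, fun hj => ?_⟩⟩
      · simpa [hj] using ⟨(ha _ (hg₂N _ (pos j ⟨0, hm0⟩).2)).1, he _⟩
      · simpa [hj] using (ha _ (hg₂N _ (pos j ⟨0, hm0⟩).2)).2
    | insert k V hkV ih =>
      intro hdisj
      have hkT : k ∉ T := fun h => Set.disjoint_left.1 hdisj h (by simp)
      have h1 := ih (hdisj.mono_right (by simp))
      -- If moving k to an even place destroys the relation, it holds along block k exactly at odd
      -- places. Making the places odd precisely on η realises η by a tuple of values of a. By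
      -- `hom₁` every η is then also realised over the single array `h ∅`, which is therefore
      -- shattered.
      by_contra h0
      refine hm T ?_
      let b : Set (Fin m) → Fin n → Fin m → ℕ := fun η j l =>
        (if j = k then decide (l ∈ η) else decide (j ∉ T ∧ j ∉ V)).toNat
      have hb : ∀ η j l, b η j l ≤ 1 := fun η j l => Bool.toNat_le _
      let h : Set (Fin m) → Fin (n * m) → ℕ := fun η p =>
        2 * g₂ p + b η (finProdFinEquiv.symm p).1 (finProdFinEquiv.symm p).2
      have hh : ∀ η, StrictMono (h η) := by
        intro η p p' hp
        have h1 : g₂ p < g₂ p' := hg₂ hp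
        have h2 := hb η (finProdFinEquiv.symm p).1 (finProdFinEquiv.symm p).2
        simp only [h]
        omega
      have hhN : ∀ η p, h η p < 2 * N₂ := by
        intro η p
        have h1 := hg₂N p p.2
        have h2 := hb η (finProdFinEquiv.symm p).1 (finProdFinEquiv.symm p).2
        simp only [h]
        omega
      have hηz : ∀ η : Set (Fin m), ∃ z : B, ∀ l,
          patternRel P Q G T
            (fun j => c (h η (pos j (if j = k then l else ⟨0, hm0⟩)))) z.1 ↔ l ∈ η := by
        intro η
        refine ⟨⟨fun j => e (g₂ (pos j ⟨0, hm0⟩)), a, fun j => c (2 * g₂ (pos j ⟨0, hm0⟩)),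
          fun j => he _⟩, fun l => ?_⟩
        let t : Fin n → ℕ := fun j => pos j (if j = k then l else ⟨0, hm0⟩)
        have ht : StrictMono t := by
          intro j j' hj
          have hj : (j : ℕ) < j' := hj
          have hl := (if j = k then l else ⟨0, hm0⟩ : Fin m).2
          simp only [t, pos, finProdFinEquiv_apply_val]
          nlinarith
        have e1 : (fun j => c (h η (pos j (if j = k then l else ⟨0, hm0⟩)))) = fun j =>
            c (2 * g₂ (t j) +
              (if j = k then decide (l ∈ η) else decide (j ∉ T ∧ j ∉ V)).toNat) := by
          funext j
          have hpos : ∀ l, h η (pos j l) = 2 * g₂ (pos j l) + b η j l := fun l => by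
            simp only [h, pos, Equiv.symm_apply_apply]
          rw [hpos]
          by_cases hj : j = k
          · subst hj; simp only [t, b, if_true]
          · simp only [t, b, if_neg hj]
        have e2 := congrFun (hom₂ t (fun j => (pos j ⟨0, hm0⟩ : ℕ)) ht hbase
          (fun j => (pos _ _).2) (fun j => (pos _ _).2))
          (T, fun j => if j = k then decide (l ∈ η) else decide (j ∉ T ∧ j ∉ V))
        rw [e1]
        -- The tuple z need not follow the moving place in block k: it is read only at indices in T,
        -- and k ∉ T.
        refine (patternRel_congr fun j hj => ?_).trans ((Iff.of_eq e2).trans ?_)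
        · have hjk : j ≠ k := fun h => hkT (h ▸ hj)
          simp [t, hjk]
        · by_cases hl : l ∈ η
          · have e3 : ∀ j, (if j = k then decide (l ∈ η) else decide (j ∉ T ∧ j ∉ V)) =
                decide (j ∉ T ∧ j ∉ V) := by
              intro j
              by_cases hj : j = k
              · subst hj; simp [hl, hkT, hkV]
              · simp [hj]
            simp only [e3]
            exact iff_of_true h1 hl
          · have e3 : ∀ j, (if j = k then decide (l ∈ η) else decide (j ∉ T ∧ j ∉ V)) =
                decide (j ∉ T ∧ j ∉ insert k V) := by
              intro j
              by_cases hj : j = k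
              · subst hj; simp [hl]
              · simp [hj]
            simp only [e3]
            exact iff_of_false h0 hl
      have hη : ∀ η : Set (Fin m), ∃ z : B, ∀ l,
          patternRel P Q G T
            (fun j => c (h ∅ (pos j (if j = k then l else ⟨0, hm0⟩)))) z.1 ↔ l ∈ η := by
        intro η
        have := congrFun (hom₁ (h ∅) (h η) (hh _) (hh _) (hhN _) (hhN _)) (T, k, η)
        exact (Iff.of_eq this).2 (hηz η)
      choose z hz using hη
      exact ⟨_, z, fun l η => hz η l⟩
  refine ⟨fun j => (c (2 * g₂ (pos j ⟨0, hm0⟩)), e (g₂ (pos j ⟨0, hm0⟩))), fun T => ?_⟩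
  have := key T (Finset.univ.filter (· ∉ T)) (by
    rw [Set.disjoint_left]; intro j hj; simp [hj])
  simpa [patternRel] using this

/-- A relation with finitely many second arguments does not shatter large families. -/
theorem exists_not_relShatters_of_finite [Finite B] (R : A → B → Prop) :
    ∃ m, ¬ RelShatters R m := by
  refine ⟨Nat.card B, ?_⟩
  rintro ⟨a, b, hab⟩
  have hinj : Function.Injective b := by
    intro S S' h
    ext i
    rw [← hab i S, ← hab i S', h]
  have h1 := Nat.card_le_card_of_injective b hinj
  have h2 : Nat.card (Set (Fin (Nat.card B))) = 2 ^ Nat.card B := by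
    rw [Nat.card_eq_fintype_card, Fintype.card_set, Fintype.card_fin]
  rw [h2] at h1
  exact absurd Nat.lt_two_pow_self (not_lt.2 h1)

theorem Patterns.attach_of_finite [Finite Z] {P Q : X → Y → Prop} (h : Patterns P Q)
    (τ : X → Y → Z) :
    Patterns (fun a (p : Y × Z) => P a p.1 ∧ τ a p.1 = p.2) fun a p => Q a p.1 :=
  h.attach (G := fun a y z => τ a y = z) (fun _ _ => ⟨_, rfl⟩)
    fun _ _ => exists_not_relShatters_of_finite _

/-- Finitely many relations that do not shatter large families do not separate the two sides of
a pattern. -/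
theorem Patterns.exists_agree {P Q : X → Y → Prop} (h : Patterns P Q) {ι : Type*} [Finite ι]
    (θ : ι → X → Y → Prop) (hθ : ∀ i, ∃ m, ¬ RelShatters (θ i) m) :
    ∃ a a' c, P a c ∧ Q a' c ∧ ∀ i, θ i a c ↔ θ i a' c := by
  let τ : X → Y → ι → Prop := fun a c i => θ i a c
  -- The truth values of the `θ i` are attached on the P side and, after exchanging the sides, on
  -- the Q side. A colouring makes both vectors constant, z and z'. Where they differ, `θ i` itself
  -- separates the two sides and shatters.
  have h1 := ((h.attach_of_finite τ).symm.attach_of_finite fun a p => τ a p.1).symm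
  obtain ⟨⟨z, z'⟩, hz⟩ := h1.exists_colour fun p => (p.1.2, p.2)
  have hpat : Patterns (fun a c => P a c ∧ ∀ i, θ i a c ↔ z i)
      fun a c => Q a c ∧ ∀ i, θ i a c ↔ z' i := by
    refine hz.map id (fun p => p.1.1) ?_ ?_
    · rintro a ⟨⟨c, y⟩, y'⟩ ⟨⟨h, h'⟩, e⟩
      obtain ⟨rfl, rfl⟩ := Prod.mk.inj e
      exact ⟨h, fun i => Iff.of_eq (congrFun h' i)⟩
    · rintro a ⟨⟨c, y⟩, y'⟩ ⟨⟨h, h'⟩, e⟩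
      obtain ⟨rfl, rfl⟩ := Prod.mk.inj e
      exact ⟨h, fun i => Iff.of_eq (congrFun h' i)⟩
  have hzz : ∀ i, z i ↔ z' i := by
    intro i
    by_contra hi
    obtain ⟨m, hm⟩ := hθ i
    suffices hpat : Patterns (θ i) fun a c => ¬ θ i a c from
      hm (RelShatters.swap (hpat.relShatters _) le_rfl)
    by_cases hzi : z i
    · have hzi' : ¬ z' i := fun h => hi (by simp [hzi, h])
      exact hpat.map id id (fun a c h => (h.2 i).2 hzi) fun a c h h' => hzi' ((h.2 i).1 h')
    · have hzi' : z' i := by_contra fun h => hi (by simp [hzi, h])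
      exact hpat.symm.map id id (fun a c h => (h.2 i).2 hzi') fun a c h h' => hzi ((h.2 i).1 h')
  obtain ⟨c, hc⟩ := hpat 1
  obtain ⟨a, ha⟩ := hc Set.univ
  obtain ⟨a', ha'⟩ := hc ∅
  have h1 := (ha 0).1 trivial
  have h2 := (ha' 0).2 (by simp)
  exact ⟨a, a', c 0, h1.1, h2.1, fun i => (h1.2 i).trans ((hzz i).trans (h2.2 i).symm)⟩

end Patterns

/-! ### Definable relations -/

section Definable

variable {L : FirstOrder.Language.{u, v}} {M : Type w} [L.Structure M] {α β γ : Type*}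

variable (L) in
/-- The relation `P` is definable in `M` without parameters. -/
def IsDef (P : (α → M) → Prop) : Prop :=
  ∃ φ : L.Formula α, ∀ v, φ.Realize v ↔ P v

theorem IsDef.congr {P Q : (α → M) → Prop} (h : IsDef L P) (hPQ : ∀ v, P v ↔ Q v) :
    IsDef L Q := by
  obtain ⟨φ, hφ⟩ := h
  exact ⟨φ, fun v => (hφ v).trans (hPQ v)⟩

theorem isDef_realize (φ : L.Formula α) : IsDef L fun v : α → M => φ.Realize v :=
  ⟨φ, fun _ => Iff.rfl⟩

theorem IsDef.comp {P : (α → M) → Prop} (h : IsDef L P) (f : α → β) :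
    IsDef L fun v : β → M => P (v ∘ f) := by
  obtain ⟨φ, hφ⟩ := h
  exact ⟨φ.relabel f, fun v => Formula.realize_relabel.trans (hφ _)⟩

theorem IsDef.not {P : (α → M) → Prop} (h : IsDef L P) : IsDef L fun v => ¬ P v := by
  obtain ⟨φ, hφ⟩ := h
  exact ⟨φ.not, fun v => Formula.realize_not.trans (not_congr (hφ v))⟩

theorem IsDef.and {P Q : (α → M) → Prop} (h : IsDef L P) (h' : IsDef L Q) :
    IsDef L fun v => P v ∧ Q v := by
  obtain ⟨φ, hφ⟩ := h
  obtain ⟨ψ, hψ⟩ := h'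
  exact ⟨φ ⊓ ψ, fun v => Formula.realize_inf.trans (and_congr (hφ v) (hψ v))⟩

theorem IsDef.imp {P Q : (α → M) → Prop} (h : IsDef L P) (h' : IsDef L Q) :
    IsDef L fun v => P v → Q v := by
  obtain ⟨φ, hφ⟩ := h
  obtain ⟨ψ, hψ⟩ := h'
  exact ⟨φ.imp ψ, fun v => Formula.realize_imp.trans (imp_congr (hφ v) (hψ v))⟩

theorem isDef_const (p : Prop) : IsDef L fun _ : α → M => p := by
  by_cases hp : p
  · exact ⟨⊤, fun v => by simp [hp]⟩
  · exact ⟨⊥, fun v => by simp [hp]⟩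

theorem IsDef.all_finite [Finite β] {P : β → (α → M) → Prop} (h : ∀ b, IsDef L (P b)) :
    IsDef L fun v => ∀ b, P b v := by
  choose φ hφ using h
  refine ⟨BoundedFormula.iInf φ, fun v => ?_⟩
  exact (BoundedFormula.realize_iInf (v := v) (v' := default)).trans
    (forall_congr' fun b => hφ b v)

theorem IsDef.exists_tuple [Finite γ] {P : (α → M) → (γ → M) → Prop}
    (h : IsDef L fun v : α ⊕ γ → M => P (v ∘ Sum.inl) (v ∘ Sum.inr)) :
    IsDef L fun v => ∃ x, P v x := by
  obtain ⟨φ, hφ⟩ := h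
  refine ⟨φ.iExs γ, fun v => Formula.realize_iExs.trans (exists_congr fun x => ?_)⟩
  rw [hφ]
  rfl

theorem IsDef.exists {P : (α → M) → M → Prop}
    (h : IsDef L fun v : α ⊕ Unit → M => P (v ∘ Sum.inl) (v (Sum.inr ()))) :
    IsDef L fun v => ∃ x, P v x := by
  have h' : IsDef L fun v => ∃ x : Unit → M, P v (x ()) :=
    IsDef.exists_tuple (P := fun v x => P v (x ())) h
  exact h'.congr fun v => ⟨fun ⟨x, hx⟩ => ⟨x (), hx⟩, fun ⟨x, hx⟩ => ⟨fun _ => x, hx⟩⟩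

theorem IsDef.forall {P : (α → M) → M → Prop}
    (h : IsDef L fun v : α ⊕ Unit → M => P (v ∘ Sum.inl) (v (Sum.inr ()))) :
    IsDef L fun v => ∀ x, P v x :=
  ((IsDef.exists (P := fun v x => ¬ P v x) h.not).not).congr fun v => by simp

/-- Only finitely many variables occur in a formula. -/
theorem exists_finite_variables (φ : L.Formula (α ⊕ β)) :
    ∃ (p : ℕ) (f : Fin p → α) (ψ : L.Formula (Fin p ⊕ β)), ∀ (v : α → M) (w : β → M),
      φ.Realize (Sum.elim v w) ↔ ψ.Realize (Sum.elim (v ∘ f) w) := by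
  classical
  let s : Finset α := φ.freeVarFinset.preimage Sum.inl Sum.inl_injective.injOn
  let e := s.equivFin
  let g : φ.freeVarFinset → Fin s.card ⊕ β := fun x => match x with
    | ⟨Sum.inl a, ha⟩ => Sum.inl (e ⟨a, Finset.mem_preimage.2 ha⟩)
    | ⟨Sum.inr b, _⟩ => Sum.inr b
  refine ⟨s.card, fun i => (e.symm i : α), BoundedFormula.restrictFreeVar φ g, fun v w => ?_⟩
  refine (BoundedFormula.realize_restrictFreeVar (Sum.elim v w) ?_).symm
  rintro ⟨a | b, ha⟩
  · simp [g]
  · simp [g]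

theorem IsDef.exists_fin {P : (α → M) → (β → M) → Prop}
    (h : IsDef L fun v : α ⊕ β → M => P (v ∘ Sum.inl) (v ∘ Sum.inr)) :
    ∃ (p : ℕ) (f : Fin p → α) (ψ : L.Formula (Fin p ⊕ β)), ∀ (v : α → M) (w : β → M),
      ψ.Realize (Sum.elim (v ∘ f) w) ↔ P v w := by
  obtain ⟨φ, hφ⟩ := h
  obtain ⟨p, f, ψ, hψ⟩ := exists_finite_variables (M := M) φ
  exact ⟨p, f, ψ, fun v w => (hψ v w).symm.trans (hφ _)⟩

end Definable

/-! ### Ultraproducts -/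

section Ultraproducts

open Filter

variable {L : FirstOrder.Language.{u, v}}

theorem Shatters.mono {p q : ℕ} {φ : L.Formula (Fin p ⊕ Fin q)} {M : Type w} [L.Structure M]
    {m n : ℕ} (h : Shatters φ M n) (hmn : m ≤ n) : Shatters φ M m :=
  RelShatters.mono (R := fun a b => φ.Realize (Sum.elim a b)) h hmn

/-- A formula that is not NIP modulo `T` shatters arbitrarily large families in a single model. -/
theorem exists_model_forall_shatters {T : L.Theory} {p q : ℕ} {φ : L.Formula (Fin p ⊕ Fin q)}
    (h : ¬ IsNIPFormula T φ) :
    ∃ (M : Type (max u v)) (_ : L.Structure M) (_ : Nonempty M) (_ : T.Model M),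
      ∀ n, Shatters φ M n := by
  unfold IsNIPFormula at h
  push Not at h
  choose M hstr hne hmod hM using h
  let N := ((hyperfilter (ULift.{max u v} ℕ) : Ultrafilter (ULift.{max u v} ℕ)) :
    Filter (ULift.{max u v} ℕ)).Product fun n => M n.down
  refine ⟨N, inferInstance, inferInstance, ⟨fun ψ hψ => ?_⟩, fun m => ?_⟩
  · rw [Ultraproduct.sentence_realize]
    exact Eventually.of_forall fun n => (hmod n.down).realize_of_mem ψ hψ
  · have hm : ∀ n : ULift.{max u v} ℕ, ∃ (a : Fin m → Fin p → M n.down)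
        (b : Set (Fin m) → Fin q → M n.down), m ≤ n.down →
        ∀ i S, φ.Realize (Sum.elim (a i) (b S)) ↔ i ∈ S := by
      intro n
      by_cases hn : m ≤ n.down
      · obtain ⟨a, b, hab⟩ := (hM n.down).mono hn
        exact ⟨a, b, fun _ => hab⟩
      · exact ⟨fun _ _ => Classical.arbitrary _, fun _ _ => Classical.arbitrary _,
          fun h => absurd h hn⟩
    choose a b hab using hm
    refine ⟨fun i j => ((fun n => a n i j : ∀ n : ULift.{max u v} ℕ, M n.down) : N),
      fun S j => ((fun n => b n S j : ∀ n : ULift.{max u v} ℕ, M n.down) : N), fun i S => ?_⟩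
    have hfin : ∀ᶠ n in (hyperfilter (ULift.{max u v} ℕ) : Filter (ULift.{max u v} ℕ)),
        m ≤ n.down := by
      have : {n : ULift.{max u v} ℕ | ¬ m ≤ n.down}.Finite := by
        refine ((Set.finite_lt_nat m).image ULift.up).subset ?_
        intro n hn
        exact ⟨n.down, not_le.1 hn, rfl⟩
      exact mem_of_superset this.compl_mem_hyperfilter fun n hn => not_not.1 hn
    have key := Ultraproduct.realize_formula_cast
      (u := hyperfilter (ULift.{max u v} ℕ)) φ
      (Sum.elim (fun j (n : ULift.{max u v} ℕ) => a n i j) fun j n => b n S j)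
    have e1 : (fun k => ((Sum.elim (fun j (n : ULift.{max u v} ℕ) => a n i j)
        (fun j n => b n S j) k : ∀ n : ULift.{max u v} ℕ, M n.down) : N)) =
        Sum.elim (fun j => ((fun n => a n i j : ∀ n : ULift.{max u v} ℕ, M n.down) : N))
          fun j => ((fun n => b n S j : ∀ n : ULift.{max u v} ℕ, M n.down) : N) := by
      funext k; cases k <;> rfl
    rw [e1] at key
    refine key.trans ?_
    have e2 : ∀ n : ULift.{max u v} ℕ, (fun k => Sum.elim (fun j (n : ULift.{max u v} ℕ) => a n i j)
        (fun j n => b n S j) k n) = Sum.elim (a n i) (b n S) := by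
      intro n; funext k; cases k <;> rfl
    simp only [e2]
    constructor
    · intro h
      obtain ⟨n, h1, h2⟩ := (h.and hfin).exists
      exact (hab n h2 i S).1 h1
    · intro h
      filter_upwards [hfin] with n hn
      exact (hab n hn i S).2 h

/-- Compactness: a family of formulas that is finitely satisfiable in `M` is satisfied in some
structure elementarily equivalent to `M`. -/
theorem exists_realize_of_finitely {M : Type (max u v)} [L.Structure M] [Nonempty M]
    {α J : Type (max u v)} (γ : J → L.Formula α)
    (h : ∀ s : Finset J, ∃ x : α → M, ∀ j ∈ s, (γ j).Realize x) :
    ∃ (U : Type (max u v)) (_ : L.Structure U) (_ : Nonempty U),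
      L.completeTheory U = L.completeTheory M ∧ ∃ x : α → U, ∀ j, (γ j).Realize x := by
  choose x hx using h
  let F : Ultrafilter (Finset J) := Ultrafilter.of atTop
  refine ⟨(F : Filter (Finset J)).Product fun _ => M, inferInstance, inferInstance, ?_,
    fun i => ((fun s => x s i : Finset J → M) : (F : Filter (Finset J)).Product fun _ => M),
    fun j => ?_⟩
  · ext ψ
    exact (Ultraproduct.sentence_realize ψ).trans eventually_const
  · refine (Ultraproduct.realize_formula_cast (u := F) (γ j) fun i s => x s i).2 ?_
    have : ∀ᶠ s in (atTop : Filter (Finset J)), {j} ≤ s := eventually_ge_atTop _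
    filter_upwards [Ultrafilter.of_le (atTop : Filter (Finset J)) this] with s hs
    exact hx s j (Finset.singleton_subset_iff.1 hs)

end Ultraproducts

/-! ### Reduction to formulas in a single variable -/

section SingleVariable

variable {L : FirstOrder.Language.{u, v}} {M : Type w} [L.Structure M]

theorem patterns_of_shatters {p q : ℕ} {φ : L.Formula (Fin p ⊕ Fin q)}
    (h : ∀ n, Shatters φ M n) :
    Patterns (fun (x : Fin p → M) (c : Fin q → M) => φ.Realize (Sum.elim x c))
      fun x c => ¬ φ.Realize (Sum.elim x c) :=
  Patterns.of_relShatters (R := fun c x => φ.Realize (Sum.elim x c)) fun _ =>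
    RelShatters.swap (R := fun x c => φ.Realize (Sum.elim x c)) (h _) le_rfl

/-- A definable relation between elements and tuples does not shatter large families if formulas
in a single variable do not. -/
theorem exists_not_relShatters_of_isDef
    (h1 : ∀ (q : ℕ) (φ : L.Formula (Fin 1 ⊕ Fin q)), ∃ n, ¬ Shatters φ M n) {α : Type*}
    {R : (α → M) → M → Prop}
    (hR : IsDef L fun v : α ⊕ Fin 1 → M => R (v ∘ Sum.inl) (v (Sum.inr 0))) :
    ∃ m, ¬ RelShatters R m := by
  obtain ⟨p, f, ψ, hψ⟩ := IsDef.exists_fin (P := fun v w => R v (w 0)) hR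
  obtain ⟨n, hn⟩ := h1 p (ψ.relabel Sum.swap)
  refine ⟨Nat.card (Set (Fin n)), fun h => hn ?_⟩
  obtain ⟨a, b, hab⟩ := h.swap (n := n) le_rfl
  refine ⟨fun i _ => a i, fun S => b S ∘ f, fun i S => ?_⟩
  rw [← hab i S, Formula.realize_relabel]
  refine Iff.trans ?_ (hψ (b S) fun _ => a i)
  refine Iff.of_eq (congrArg _ ?_)
  funext k; cases k <;> rfl

/-- Induction on p: the first coordinate of x is attached to the parameters and becomes one of them.
The attached tuples are constant with value `x 0`, so for T ≠ ∅ the pattern relation is a definable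
relation with a single variable on the side of z, to which `h1` applies. -/
theorem not_patterns_of_single_variable
    (h1 : ∀ (q : ℕ) (φ : L.Formula (Fin 1 ⊕ Fin q)), ∃ n, ¬ Shatters φ M n) (p : ℕ) :
    ∀ (q : ℕ) (φ : L.Formula (Fin p ⊕ Fin q)),
      ¬ Patterns (fun (x : Fin p → M) (c : Fin q → M) => φ.Realize (Sum.elim x c))
        fun x c => ¬ φ.Realize (Sum.elim x c) := by
  induction p with
  | zero =>
    intro q φ h
    obtain ⟨c, hc⟩ := h 1
    obtain ⟨a, ha⟩ := hc Set.univ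
    obtain ⟨a', ha'⟩ := hc ∅
    have := (ha' 0).2 (by simp)
    rw [Subsingleton.elim a' a] at this
    exact this ((ha 0).1 trivial)
  | succ p ih =>
    intro q φ h
    have hatt := h.attach (Z := M) (G := fun x _ z => x 0 = z) (fun _ _ => ⟨_, rfl⟩) (by
      intro n T
      -- For T = ∅ the relation does not read z at all, so it cannot shatter even one point.
      rcases T.eq_empty_or_nonempty with rfl | ⟨j₀, hj₀⟩
      · refine ⟨1, ?_⟩
        rintro ⟨a, b, hab⟩
        have h1 := (hab 0 Set.univ).2 trivial
        exact (hab 0 ∅).1 ((patternRel_congr (fun j hj => hj.elim)).1 h1)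
      · let R : (Fin n × Fin q → M) → M → Prop := fun y z => ∃ x : Fin p → M, ∀ j,
          (j ∈ T → φ.Realize (Sum.elim (Fin.cons z x) fun k => y (j, k))) ∧
            (j ∉ T → ¬ φ.Realize (Sum.elim (Fin.cons z x) fun k => y (j, k)))
        obtain ⟨m, hm⟩ := exists_not_relShatters_of_isDef h1 (R := R) (by
          refine IsDef.exists_tuple (P := fun (v : (Fin n × Fin q) ⊕ Fin 1 → M) (x : Fin p → M) =>
            ∀ j, (j ∈ T → φ.Realize (Sum.elim (Fin.cons (v (Sum.inr 0)) x)
              fun k => v (Sum.inl (j, k)))) ∧ (j ∉ T → ¬ φ.Realize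
              (Sum.elim (Fin.cons (v (Sum.inr 0)) x) fun k => v (Sum.inl (j, k))))) ?_
          refine IsDef.all_finite fun j => ?_
          have : IsDef L fun v : ((Fin n × Fin q) ⊕ Fin 1) ⊕ Fin p → M =>
              φ.Realize (Sum.elim (Fin.cons (v (Sum.inl (Sum.inr 0))) (v ∘ Sum.inr))
                fun k => v (Sum.inl (Sum.inl (j, k)))) := by
            refine ((isDef_realize φ).comp (Sum.elim (Fin.cons (Sum.inl (Sum.inr 0)) Sum.inr)
              fun k => Sum.inl (Sum.inl (j, k)))).congr fun v => ?_
            refine Iff.of_eq (congrArg _ ?_)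
            funext k
            rcases k with k | k
            · refine Fin.cases ?_ (fun k => ?_) k <;> rfl
            · rfl
          exact ((isDef_const _).imp this).and ((isDef_const _).imp this.not))
        refine ⟨m, ?_⟩
        rintro ⟨a, b, hab⟩
        refine hm ⟨fun i k => a i k.1 k.2, fun S => (b S).1 j₀, fun i S => ?_⟩
        rw [← hab i S]
        obtain ⟨x₀, -, hx₀⟩ := (b S).2
        constructor
        · rintro ⟨x, hx⟩
          refine ⟨Fin.cons ((b S).1 j₀) x, fun j => ⟨fun hj => ⟨(hx j).1 hj, ?_⟩, (hx j).2⟩⟩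
          exact (hx₀ j₀).symm.trans (hx₀ j)
        · rintro ⟨x, hx⟩
          have hx0 : x 0 = (b S).1 j₀ := ((hx j₀).1 hj₀).2
          refine ⟨Fin.tail x, ?_⟩
          beta_reduce
          rw [← hx0, Fin.cons_self_tail]
          exact fun j => ⟨fun hj => ((hx j).1 hj).1, (hx j).2⟩)
    refine ih (q + 1) (φ.relabel (Sum.elim (Fin.cons (Sum.inr 0) Sum.inl) (Sum.inr ∘ Fin.succ))) ?_
    have hre : ∀ (x : Fin (p + 1) → M) (y : Fin q → M),
        (φ.relabel (Sum.elim (Fin.cons (Sum.inr 0) Sum.inl : Fin (p + 1) → Fin p ⊕ Fin (q + 1))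
          (Sum.inr ∘ Fin.succ))).Realize
          (Sum.elim (Fin.tail x) (Fin.cons (x 0) y : Fin (q + 1) → M)) ↔
        φ.Realize (Sum.elim x y) := by
      intro x y
      rw [Formula.realize_relabel]
      refine Iff.of_eq (congrArg _ ?_)
      funext k
      rcases k with k | k
      · refine Fin.cases ?_ (fun k => ?_) k <;> rfl
      · rfl
    intro n
    obtain ⟨c, hc⟩ := hatt (n + 1)
    refine ⟨fun j => Fin.cons (c (Fin.last n)).2 (c j.castSucc).1, fun T => ?_⟩
    -- The additional last index always lies on the P side, so all the realisations x share the
    -- first coordinate attached to it.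
    obtain ⟨x, hx⟩ := hc (insert (Fin.last n) (Fin.castSucc '' T))
    have hlast := ((hx (Fin.last n)).1 (Set.mem_insert _ _)).2
    refine ⟨Fin.tail x, fun j => ?_⟩
    beta_reduce
    rw [← hlast, hre]
    refine ⟨fun hj => ((hx j.castSucc).1 (Or.inr ⟨j, hj, rfl⟩)).1, fun hj => (hx j.castSucc).2 ?_⟩
    rintro (h' | ⟨j', hj', h'⟩)
    · exact (Fin.castSucc_lt_last j).ne h'
    · rw [Fin.castSucc_injective _ h'] at hj'
      exact hj hj'

end SingleVariable

/-! ### Stably embedded NIP sorts -/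

section StablyEmbedded

variable {L : FirstOrder.Language.{u, v}} {M : Type w} [L.Structure M] {D : Type (max u v)}
  [Nonempty D] {X : Set M} {π : X → D}

/-- If `D` is stably embedded and NIP, definable relations between tuples of elements of `M` and
tuples of elements of `D` do not shatter large families. -/
theorem exists_not_relShatters_of_stablyEmbedded (hSE : IsStablyEmbedded L π)
    (hNIP : IsNIPTheory (inducedTheory L π)) {α : Type*} {n : ℕ} (ρ : L.Formula (α ⊕ Fin n)) :
    ∃ m, ¬ RelShatters (fun (x : α → M) (d : Fin n → D) =>
      ∃ y : Fin n → X, (∀ j, π (y j) = d j) ∧ ρ.Realize (Sum.elim x fun j => (y j : M))) m := by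
  obtain ⟨p, f, ρ', hρ'⟩ := exists_finite_variables (M := M) ρ
  obtain ⟨q, ψ, hψ⟩ := hSE p n ρ'
  let e : Fin q ⊕ Fin n ≃ Fin (q + n) := finSumFinEquiv
  let R : (inducedLanguage L).Relations (q + n) := ψ.relabel e
  let Φ : (inducedLanguage L).Formula (Fin q ⊕ Fin n) := R.formula fun i => Term.var (e.symm i)
  obtain ⟨m, hm⟩ := hNIP q n Φ
  let _ := inducedStructure L π
  have hmod : (inducedTheory L π).Model D := by
    unfold inducedTheory
    infer_instance
  refine ⟨m, ?_⟩
  rintro ⟨a, d, had⟩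
  -- One formula ψ serves all tuples, so replacing each `a i` by a tuple of D turns the relation
  -- into a single formula of the induced structure.
  choose b hb using fun i => hψ (a i ∘ f)
  refine @hm D _ _ hmod ⟨b, d, fun i S => ?_⟩
  rw [← had i S]
  have h1 : d S ∈ traceOn π ρ' (a i ∘ f) ↔ Sum.elim (b i) (d S) ∈ inducedRel π ψ := by
    rw [hb i]; rfl
  have h2 : d S ∈ traceOn π ρ' (a i ∘ f) ↔ ∃ y : Fin n → X, (∀ j, π (y j) = d S j) ∧
      ρ.Realize (Sum.elim (a i) fun j => (y j : M)) :=
    exists_congr fun y => and_congr_right fun _ => (hρ' _ _).symm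
  refine Iff.trans ?_ (h1.symm.trans h2)
  change (fun j => Sum.elim (b i) (d S) (e.symm j)) ∈ inducedRel π (ψ.relabel e) ↔ _
  constructor
  · rintro ⟨y, hy, hyψ⟩
    refine ⟨y ∘ e, fun j => ?_, (Formula.realize_relabel (v := fun j => (y j : M))).1 hyψ⟩
    exact (hy _).trans (congrArg _ (e.symm_apply_apply j))
  · rintro ⟨y, hy, hyψ⟩
    refine ⟨y ∘ e.symm, fun j => hy _, Formula.realize_relabel.2 ?_⟩
    convert hyψ using 2 with j
    simp

end StablyEmbedded

/-! ### Lifting elements of a stably embedded NIP sort -/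

section Lifting

variable {L : FirstOrder.Language.{u, v}}

/-- The formula `ε` defines the equivalence relation that presents a stably embedded NIP sort
of `M`. -/
def PresentsNIPSort (M : Type w) [L.Structure M] (ε : L.Formula (Fin 2)) : Prop :=
  ∃ (D : Type (max u v)) (_ : Nonempty D) (X : Set M) (π : X → D), Function.Surjective π ∧
    (∀ z z', ε.Realize ![z, z'] ↔ ∃ (h : z ∈ X) (h' : z' ∈ X), π ⟨z, h⟩ = π ⟨z', h'⟩) ∧
    IsStablyEmbedded L π ∧ IsNIPTheory (inducedTheory L π)

/-- The formula `E(y; z)` defines in `z` a class of the equivalence relation `ε`. -/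
def IsClassOf {M : Type w} [L.Structure M] (ε : L.Formula (Fin 2)) {α : Type*}
    (E : L.Formula (α ⊕ Unit)) (y : α → M) : Prop :=
  ∃ z, ε.Realize ![z, z] ∧ ∀ z', E.Realize (Sum.elim y fun _ => z') ↔ ε.Realize ![z, z']

/-- The formula that expresses `IsClassOf`. -/
noncomputable def classFormula (ε : L.Formula (Fin 2)) {α : Type*} (E : L.Formula (α ⊕ Unit)) :
    L.Formula α :=
  ((ε.relabel ![Sum.inr (), Sum.inr ()] : L.Formula (α ⊕ Unit)) ⊓
    ((E.relabel (Sum.elim (Sum.inl ∘ Sum.inl) Sum.inr) : L.Formula ((α ⊕ Unit) ⊕ Unit)).iff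
      (ε.relabel ![Sum.inl (Sum.inr ()), Sum.inr ()])).iAlls Unit).iExs Unit

theorem comp_vec_two {α β : Type*} (x : α → β) (i j : α) : x ∘ ![i, j] = ![x i, x j] := by
  funext k; fin_cases k <;> rfl

theorem realize_classFormula {M : Type w} [L.Structure M] (ε : L.Formula (Fin 2)) {α : Type*}
    (E : L.Formula (α ⊕ Unit)) (y : α → M) :
    (classFormula ε E).Realize y ↔ IsClassOf ε E y := by
  have e' : ∀ z z' : Unit → M, (Sum.elim (Sum.elim y z) z' ∘
      (Sum.elim (Sum.inl ∘ Sum.inl) Sum.inr : α ⊕ Unit → (α ⊕ Unit) ⊕ Unit)) = Sum.elim y z' := by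
    intro z z'; funext k; cases k <;> rfl
  simp only [classFormula, Formula.realize_iExs, Formula.realize_inf, Formula.realize_iAlls,
    Formula.realize_iff, Formula.realize_relabel, comp_vec_two, e', Sum.elim_inl, Sum.elim_inr, IsClassOf]
  constructor
  · rintro ⟨z, h, h'⟩
    exact ⟨z (), h, fun z' => h' fun _ => z'⟩
  · rintro ⟨z, h, h'⟩
    exact ⟨fun _ => z, h, fun z' => h' (z' ())⟩

/-- The relation between an element `x` and an assignment `c` expressed by a formula. -/
abbrev evalAt {M : Type w} [L.Structure M] {Λ : Type*} (ψ : L.Formula (Λ ⊕ Unit)) (x : M)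
    (c : Λ → M) : Prop :=
  ψ.Realize (Sum.elim c fun _ => x)

/-- A value in a stably embedded NIP sort that is defined from the two sides of a pattern may be
lifted to a new coordinate. -/
theorem Patterns.lift {M : Type w} [L.Structure M] {ε : L.Formula (Fin 2)}
    (hε : PresentsNIPSort M ε) {Λ : Type*} [DecidableEq Λ] {ψ χ : L.Formula (Λ ⊕ Unit)}
    (h : Patterns (evalAt (M := M) ψ) (evalAt χ)) {n : ℕ}
    (E : L.Formula ((Fin n ⊕ Unit) ⊕ Unit)) (args : Fin n → Λ) (l : Λ)
    (hψ : ∀ x c z, evalAt (M := M) ψ x (Function.update c l z) ↔ evalAt ψ x c)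
    (hχ : ∀ x c z, evalAt (M := M) χ x (Function.update c l z) ↔ evalAt χ x c)
    (hargs : ∀ i, args i ≠ l) :
    Patterns (fun (x : M) (c : Λ → M) => evalAt ψ x c ∧
      (IsClassOf ε E (Sum.elim (c ∘ args) fun _ => x) →
        E.Realize (Sum.elim (Sum.elim (c ∘ args) fun _ => x) fun _ => c l))) (evalAt χ) := by
  obtain ⟨D, hD, X, π, hπ, hεπ, hSE, hNIP⟩ := hε
  let cl : M → (Λ → M) → Prop := fun x c => IsClassOf ε E (Sum.elim (c ∘ args) fun _ => x)
  let val : M → (Λ → M) → M → Prop := fun x c z =>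
    E.Realize (Sum.elim (Sum.elim (c ∘ args) fun _ => x) fun _ => z)
  -- If E defines a class, d is that class. If not, the condition is vacuous, so a value always
  -- exists.
  let G : M → (Λ → M) → D → Prop := fun x c d => ∀ z : X, π z = d → cl x c → val x c z
  have hGval : ∀ x c (z : X), G x c (π z) ↔ (cl x c → val x c z) := by
    intro x c z
    refine ⟨fun h => h z rfl, ?_⟩
    rintro h z' hz' hcl
    obtain ⟨z₀, hz₀, hE⟩ := hcl
    obtain ⟨h1, h2, h3⟩ := (hεπ _ _).1 ((hE _).1 (h ⟨z₀, hz₀, hE⟩))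
    exact (hE _).2 ((hεπ _ _).2 ⟨h1, z'.2, h3.trans hz'.symm⟩)
  have hatt := h.attach (G := G) (by
      intro x c
      by_cases hcl : cl x c
      · obtain ⟨z₀, hz₀, hE⟩ := hcl
        obtain ⟨h1, -⟩ := (hεπ _ _).1 hz₀
        exact ⟨π ⟨z₀, h1⟩, (hGval _ _ _).2 fun _ => (hE _).2 hz₀⟩
      · exact ⟨Classical.arbitrary D, fun z _ h' => absurd h' hcl⟩) (by
    intro m T
    -- With x quantified away and values replaced by representatives, the pattern relation is a
    -- definable relation between M and D, which does not shatter large families.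
    obtain ⟨ρ, hρ⟩ : IsDef L fun v : (Fin m × Λ) ⊕ Fin m → M => ∃ x, ∀ j,
        (j ∈ T → evalAt ψ x (fun i => v (Sum.inl (j, i))) ∧
          (cl x (fun i => v (Sum.inl (j, i))) →
            val x (fun i => v (Sum.inl (j, i))) (v (Sum.inr j)))) ∧
        (j ∉ T → evalAt χ x fun i => v (Sum.inl (j, i))) := by
      refine IsDef.exists (P := fun (v : (Fin m × Λ) ⊕ Fin m → M) (x : M) => ∀ j,
        (j ∈ T → evalAt ψ x (fun i => v (Sum.inl (j, i))) ∧
          (cl x (fun i => v (Sum.inl (j, i))) →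
            val x (fun i => v (Sum.inl (j, i))) (v (Sum.inr j)))) ∧
        (j ∉ T → evalAt χ x fun i => v (Sum.inl (j, i)))) (IsDef.all_finite fun j => ?_)
      have hform : ∀ ψ : L.Formula (Λ ⊕ Unit), IsDef L
          fun v : ((Fin m × Λ) ⊕ Fin m) ⊕ Unit → M =>
            evalAt ψ (v (Sum.inr ())) fun i => v (Sum.inl (Sum.inl (j, i))) := fun ψ =>
        ((isDef_realize ψ).comp
          (Sum.elim (fun i => Sum.inl (Sum.inl (j, i))) fun _ => Sum.inr ())).congr fun v =>
          Iff.of_eq (congrArg _ (by funext k; cases k <;> rfl))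
      have hcl : IsDef L fun v : ((Fin m × Λ) ⊕ Fin m) ⊕ Unit → M =>
          cl (v (Sum.inr ())) fun i => v (Sum.inl (Sum.inl (j, i))) :=
        ((isDef_realize (classFormula ε E)).comp
          (Sum.elim (fun i => Sum.inl (Sum.inl (j, args i))) fun _ => Sum.inr ())).congr fun v =>
          (realize_classFormula _ _ _).trans
            (Iff.of_eq (congrArg _ (by funext k; cases k <;> rfl)))
      have hval : IsDef L fun v : ((Fin m × Λ) ⊕ Fin m) ⊕ Unit → M =>
          val (v (Sum.inr ())) (fun i => v (Sum.inl (Sum.inl (j, i))))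
            (v (Sum.inl (Sum.inr j))) :=
        ((isDef_realize E).comp
          (Sum.elim (Sum.elim (fun i => Sum.inl (Sum.inl (j, args i))) fun _ => Sum.inr ())
            fun _ => Sum.inl (Sum.inr j))).congr fun v =>
          Iff.of_eq (congrArg _ (by funext k; rcases k with (k | k) | k <;> rfl))
      exact ((isDef_const _).imp ((hform ψ).and (hcl.imp hval))).and
        ((isDef_const _).imp (hform χ))
    obtain ⟨N, hN⟩ := exists_not_relShatters_of_stablyEmbedded hSE hNIP ρ
    refine ⟨N, ?_⟩
    rintro ⟨a, b, hab⟩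
    refine hN ⟨fun i k => a i k.1 k.2, fun S => (b S).1, fun i S => ?_⟩
    rw [← hab i S]
    constructor
    · rintro ⟨y, hy, hyρ⟩
      obtain ⟨x, hx⟩ := (hρ _).1 hyρ
      refine ⟨x, fun j => ⟨fun hj => ⟨((hx j).1 hj).1, ?_⟩, (hx j).2⟩⟩
      rw [show (b S).1 j = π (y j) from (hy j).symm]
      exact (hGval _ _ _).2 ((hx j).1 hj).2
    · rintro ⟨x, hx⟩
      choose y hy using fun j => hπ ((b S).1 j)
      refine ⟨y, hy, (hρ _).2 ⟨x, fun j => ⟨fun hj => ⟨((hx j).1 hj).1, ?_⟩, (hx j).2⟩⟩⟩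
      exact ((hx j).1 hj).2 (y j) (hy j))
  -- A section of π writes the attached value into coordinate l, which ψ, χ and `args` do not see.
  choose s hs using hπ
  refine hatt.map id (fun p => Function.update p.1 l (s p.2)) ?_ ?_
  · rintro x ⟨c, d⟩ ⟨h1, h2⟩
    have e : Function.update c l (s d : M) ∘ args = c ∘ args := by
      funext i
      exact Function.update_of_ne (hargs i) _ _
    refine ⟨(hψ _ _ _).2 h1, ?_⟩
    simp only [e, Function.update_self]
    exact h2 (s d) (hs d)
  · rintro x ⟨c, d⟩ h1
    exact (hχ _ _ _).2 h1

end Lifting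

/-! ### Witnesses -/

section Witnesses

variable {L : FirstOrder.Language.{u, v}} {κ : Type} {q : ℕ}

variable (L κ q) in
/-- Variables for `q` given elements, for witnesses of existential formulas, and for lifts of
elements of sorts that are indexed by `κ`. -/
inductive WitnessVar : Type (max u v)
  | base (i : Fin q) : WitnessVar
  | wit (n : ℕ) (E : L.Formula (Fin n ⊕ Unit)) (args : Fin n → WitnessVar) : WitnessVar
  | lift (k : κ) (n : ℕ) (E : L.Formula ((Fin n ⊕ Unit) ⊕ Unit)) (args : Fin n → WitnessVar) :
    WitnessVar

/-- The depth of the construction of a witness variable. -/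
noncomputable def WitnessVar.height : WitnessVar L κ q → ℕ
  | base _ => 0
  | wit _ _ args => (Finset.univ.sup fun i => (args i).height) + 1
  | lift _ _ _ args => (Finset.univ.sup fun i => (args i).height) + 1

/-- The condition that determines the meaning of a witness variable, in which the variable `()`
stands for an element that is not among the witnesses. -/
noncomputable def WitnessVar.ax (ε : κ → L.Formula (Fin 2)) :
    WitnessVar L κ q → L.Formula (WitnessVar L κ q ⊕ Unit)
  | base _ => ⊤
  | wit n E args =>
    ((E.iExs Unit).relabel (Sum.inl ∘ args)).imp
      (E.relabel (Sum.elim (Sum.inl ∘ args) fun _ => Sum.inl (wit n E args)))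
  | lift k n E args =>
    ((classFormula (ε k) E).relabel (Sum.elim (Sum.inl ∘ args) Sum.inr)).imp
      (E.relabel (Sum.elim (Sum.elim (Sum.inl ∘ args) Sum.inr)
        fun _ => Sum.inl (lift k n E args)))

variable {M : Type w} [L.Structure M] {ε : κ → L.Formula (Fin 2)}

theorem evalAt_ax_wit {n : ℕ} {E : L.Formula (Fin n ⊕ Unit)}
    {args : Fin n → WitnessVar L κ q} {x : M} {c : WitnessVar L κ q → M} :
    evalAt ((WitnessVar.wit n E args).ax ε) x c ↔
      ((∃ z, E.Realize (Sum.elim (c ∘ args) fun _ => z)) →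
        E.Realize (Sum.elim (c ∘ args) fun _ => c (.wit n E args))) := by
  rw [evalAt, WitnessVar.ax, Formula.realize_imp, Formula.realize_relabel,
    Formula.realize_relabel, Formula.realize_iExs]
  refine imp_congr ⟨fun ⟨z, hz⟩ => ⟨z (), hz⟩, fun ⟨z, hz⟩ => ⟨fun _ => z, hz⟩⟩ ?_
  refine Iff.of_eq (congrArg _ ?_)
  funext k; cases k <;> rfl

theorem evalAt_ax_lift {k : κ} {n : ℕ} {E : L.Formula ((Fin n ⊕ Unit) ⊕ Unit)}
    {args : Fin n → WitnessVar L κ q} {x : M} {c : WitnessVar L κ q → M} :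
    evalAt ((WitnessVar.lift k n E args).ax ε) x c ↔
      (IsClassOf (ε k) E (Sum.elim (c ∘ args) fun _ => x) →
        E.Realize (Sum.elim (Sum.elim (c ∘ args) fun _ => x) fun _ => c (.lift k n E args))) := by
  rw [evalAt, WitnessVar.ax, Formula.realize_imp, Formula.realize_relabel,
    Formula.realize_relabel, realize_classFormula]
  refine imp_congr (Iff.of_eq (congrArg _ ?_)) (Iff.of_eq (congrArg _ ?_))
  · funext k; cases k <;> rfl
  · funext k; rcases k with (k | k) | k <;> rfl

theorem WitnessVar.height_lt_wit {n : ℕ} (E : L.Formula (Fin n ⊕ Unit))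
    (args : Fin n → WitnessVar L κ q) (i : Fin n) :
    (args i).height < (WitnessVar.wit n E args).height :=
  Nat.lt_succ_of_le (Finset.le_sup (f := fun i => (args i).height) (Finset.mem_univ i))

theorem WitnessVar.height_lt_lift {k : κ} {n : ℕ} (E : L.Formula ((Fin n ⊕ Unit) ⊕ Unit))
    (args : Fin n → WitnessVar L κ q) (i : Fin n) :
    (args i).height < (WitnessVar.lift k n E args).height :=
  Nat.lt_succ_of_le (Finset.le_sup (f := fun i => (args i).height) (Finset.mem_univ i))

/-- The arguments of a witness variable have smaller height, so coordinates other than l of the same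
or greater height do not affect its condition. -/
theorem evalAt_ax_congr {l : WitnessVar L κ q} {x : M} {c c' : WitnessVar L κ q → M}
    (h : c l = c' l) (h' : ∀ l', l'.height < l.height → c l' = c' l') :
    evalAt (l.ax ε) x c ↔ evalAt (l.ax ε) x c' := by
  cases l with
  | base i => exact Iff.rfl
  | wit n E args =>
    have e : c ∘ args = c' ∘ args := funext fun i => h' _ (WitnessVar.height_lt_wit E args i)
    rw [evalAt_ax_wit, evalAt_ax_wit, e, h]
  | lift k n E args =>
    have e : c ∘ args = c' ∘ args := funext fun i => h' _ (WitnessVar.height_lt_lift E args i)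
    rw [evalAt_ax_lift, evalAt_ax_lift, e, h]

/-- The formula `φ(x; y)` in the variable `()` and the base variables. -/
def onBase (φ : L.Formula (Fin 1 ⊕ Fin q)) : L.Formula (WitnessVar L κ q ⊕ Unit) :=
  φ.relabel (Sum.elim (fun _ => Sum.inr ()) fun i => Sum.inl (.base i))

theorem evalAt_onBase (φ : L.Formula (Fin 1 ⊕ Fin q)) (x : M) (c : WitnessVar L κ q → M) :
    evalAt (onBase φ) x c ↔ φ.Realize (Sum.elim (fun _ => x) fun i => c (.base i)) := by
  rw [evalAt, onBase, Formula.realize_relabel]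
  refine Iff.of_eq (congrArg _ ?_)
  funext k; cases k <;> rfl

/-- Patterns may be assumed to satisfy finitely many of the conditions on witness variables. -/
theorem patterns_with_witnesses [Nonempty M] (hε : ∀ k, PresentsNIPSort M (ε k))
    {φ : L.Formula (Fin 1 ⊕ Fin q)} (hφ : ∀ n, Shatters φ M n)
    (F : Finset (WitnessVar L κ q)) :
    Patterns (fun (x : M) c => evalAt (onBase φ) x c ∧ ∀ l ∈ F, evalAt (l.ax ε) x c)
      fun x c => ¬ evalAt (onBase φ) x c := by
  classical
  have hupd : ∀ (l : WitnessVar L κ q), (∀ i, l ≠ .base i) → ∀ x (c : _ → M) z,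
      evalAt (onBase φ) x (Function.update c l z) ↔ evalAt (onBase φ) x c := by
    intro l hl x c z
    rw [evalAt_onBase, evalAt_onBase]
    simp only [Function.update_of_ne (hl _).symm]
  -- Conditions are imposed in order of height, so that the coordinate being set is not read by
  -- those already imposed.
  refine Finset.induction_on_max_value (fun l : WitnessVar L κ q => l.height) F ?_ ?_
  · refine (patterns_of_shatters hφ).map (fun x => x 0)
      (fun c l => match l with
        | .base i => c i
        | _ => Classical.arbitrary M) ?_ ?_
    · intro x c h
      refine ⟨?_, by simp⟩
      rw [evalAt_onBase]
      convert h using 3 with i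
      rw [Subsingleton.elim i 0]
    · intro x c h
      rw [evalAt_onBase]
      convert h using 4 with i
      rw [Subsingleton.elim i 0]
  · intro l F hlF hmax ih
    have hax : ∀ x (c : _ → M) z, (∀ l' ∈ F, evalAt (l'.ax ε) x (Function.update c l z)) ↔
        ∀ l' ∈ F, evalAt (l'.ax ε) x c := by
      intro x c z
      refine forall₂_congr fun l' hl' => evalAt_ax_congr ?_ ?_
      · exact Function.update_of_ne (fun h : l' = l => hlF (h ▸ hl')) _ _
      · intro l'' hl''
        refine Function.update_of_ne (fun h => ?_) _ _
        rw [h] at hl''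
        exact absurd (hmax l' hl') (not_le.2 hl'')
    cases l with
    | base i =>
      refine ih.map id id (fun x c h => ⟨h.1, ?_⟩) fun x c h => h
      rw [Finset.forall_mem_insert]
      exact ⟨Formula.realize_top.2 trivial, h.2⟩
    | wit n E args =>
      have hb := hupd (.wit n E args) fun i h => by cases h
      -- An existential witness depends on c alone and not on x, so it is chosen directly; only
      -- lifts require attaching.
      have hw : ∀ c : WitnessVar L κ q → M, ∃ z,
          (∃ z, E.Realize (Sum.elim (c ∘ args) fun _ => z)) →
            E.Realize (Sum.elim (c ∘ args) fun _ => z) := by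
        intro c
        by_cases h : ∃ z, E.Realize (Sum.elim (c ∘ args) fun _ => z)
        · exact ⟨h.choose, fun _ => h.choose_spec⟩
        · exact ⟨Classical.arbitrary M, fun h' => absurd h' h⟩
      choose z hz using hw
      refine ih.map id (fun c => Function.update c (.wit n E args) (z c)) ?_ ?_
      · intro x c h
        refine ⟨(hb _ _ _).2 h.1, ?_⟩
        rw [Finset.forall_mem_insert]
        refine ⟨?_, (hax _ _ _).2 h.2⟩
        have e : Function.update c (.wit n E args) (z c) ∘ args = c ∘ args := by
          funext i
          refine Function.update_of_ne (fun h => ?_) _ _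
          exact (WitnessVar.height_lt_wit E args i).ne (congrArg _ h)
        rw [evalAt_ax_wit, e, Function.update_self]
        exact hz c
      · intro x c h
        exact fun h' => h ((hb _ _ _).1 h')
    | lift k n E args =>
      have hb := hupd (.lift k n E args) fun i h => by cases h
      let ψ : L.Formula (WitnessVar L κ q ⊕ Unit) :=
        onBase φ ⊓ BoundedFormula.iInf fun l : F => l.1.ax ε
      have hψ : ∀ x (c : _ → M), evalAt ψ x c ↔
          evalAt (onBase φ) x c ∧ ∀ l ∈ F, evalAt (l.ax ε) x c := by
        intro x c
        refine Formula.realize_inf.trans (and_congr_right fun _ => ?_)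
        exact BoundedFormula.realize_iInf.trans Subtype.forall
      have ih' : Patterns (evalAt (M := M) ψ) (evalAt (onBase φ).not) :=
        ih.map id id (fun x c h => (hψ x c).2 h) fun x c h => Formula.realize_not.2 h
      have := ih'.lift (hε k) E args (.lift k n E args)
        (fun x c z => by rw [hψ, hψ, hb, hax])
        (fun x c z => by
          rw [evalAt, evalAt, Formula.realize_not, Formula.realize_not]
          exact not_congr (hb x c z))
        fun i h => (WitnessVar.height_lt_lift E args i).ne (congrArg _ h)
      refine this.map id id (fun x c h => ?_) fun x c h => Formula.realize_not.1 h
      have h1 := (hψ x c).1 h.1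
      refine ⟨h1.1, ?_⟩
      rw [Finset.forall_mem_insert]
      exact ⟨evalAt_ax_lift.2 h.2, h1.2⟩

end Witnesses

/-! ### Definable elements -/

section DefinableElements

variable {L : FirstOrder.Language.{u, v}} {U : Type w} [L.Structure U] {α : Type*}

variable (L) in
/-- The element `u` is definable from the elements `v i`. -/
def InDcl (v : α → U) (u : U) : Prop :=
  ∃ E : L.Formula (α ⊕ Unit), ∀ z, E.Realize (Sum.elim v fun _ => z) ↔ z = u

theorem inDcl_apply (v : α → U) (i : α) : InDcl L v (v i) := by
  refine ⟨(Term.var (Sum.inr ())).equal (Term.var (Sum.inl i)), fun z => ?_⟩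
  simp [Formula.realize_equal]

/-- The image of an element definable from `v` under a relation definable from `v`. -/
theorem InDcl.exists_image {v : α → U} {u : U} (h : InDcl L v u)
    (H : L.Formula ((α ⊕ Unit) ⊕ Unit)) :
    ∃ E : L.Formula (α ⊕ Unit), ∀ z, E.Realize (Sum.elim v fun _ => z) ↔
      H.Realize (Sum.elim (Sum.elim v fun _ => u) fun _ => z) := by
  obtain ⟨E, hE⟩ := h
  obtain ⟨E', hE'⟩ : IsDef L fun x : α ⊕ Unit → U => ∃ w,
      E.Realize (Sum.elim (x ∘ Sum.inl) fun _ => w) ∧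
        H.Realize (Sum.elim (Sum.elim (x ∘ Sum.inl) fun _ => w) fun _ => x (Sum.inr ())) := by
    refine IsDef.exists (P := fun (x : α ⊕ Unit → U) w =>
      E.Realize (Sum.elim (x ∘ Sum.inl) fun _ => w) ∧
        H.Realize (Sum.elim (Sum.elim (x ∘ Sum.inl) fun _ => w) fun _ => x (Sum.inr ()))) ?_
    refine IsDef.and ?_ ?_
    · exact ((isDef_realize E).comp (Sum.elim (fun i => Sum.inl (Sum.inl i)) Sum.inr)).congr
        fun x => Iff.of_eq (congrArg _ (by funext k; cases k <;> rfl))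
    · exact ((isDef_realize H).comp (Sum.elim (Sum.elim (fun i => Sum.inl (Sum.inl i)) Sum.inr)
        fun _ => Sum.inl (Sum.inr ()))).congr
        fun x => Iff.of_eq (congrArg _ (by funext k; rcases k with (k | k) | k <;> rfl))
  refine ⟨E', fun z => (hE' _).trans ⟨?_, fun h => ⟨u, (hE u).2 rfl, h⟩⟩⟩
  rintro ⟨w, h1, h2⟩
  obtain rfl := (hE w).1 h1
  exact h2

theorem InDcl.map₂ {v : α → U} {u₁ u₂ u : U} (h₁ : InDcl L v u₁) (h₂ : InDcl L v u₂)
    (H : L.Formula (Fin 3)) (hH : ∀ z, H.Realize ![u₁, u₂, z] ↔ z = u) : InDcl L v u := by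
  obtain ⟨E₂, hE₂⟩ := h₂
  have h₂' : InDcl L (Sum.elim v fun _ : Unit => u₁) u₂ := by
    refine ⟨E₂.relabel (Sum.elim (Sum.inl ∘ Sum.inl) Sum.inr), fun z => ?_⟩
    rw [← hE₂ z, Formula.realize_relabel]
    exact Iff.of_eq (congrArg _ (by funext k; cases k <;> rfl))
  obtain ⟨E, hE⟩ := h₂'.exists_image
    (H.relabel ![Sum.inl (Sum.inl (Sum.inr ())), Sum.inl (Sum.inr ()), Sum.inr ()])
  obtain ⟨E', hE'⟩ := h₁.exists_image E
  refine ⟨E', fun z => ?_⟩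
  rw [hE', hE, ← hH, Formula.realize_relabel]
  exact Iff.of_eq (congrArg _ (by funext k; fin_cases k <;> rfl))

/-- If the conditions on witness variables hold, every class of an element that is definable from
the witnesses and `a` contains a witness. -/
theorem exists_lift_of_inDcl {κ : Type} {q : ℕ} {ε : κ → L.Formula (Fin 2)}
    {c : WitnessVar L κ q → U} {a : U} (hax : ∀ l : WitnessVar L κ q, evalAt (l.ax ε) a c)
    {u : U} (hu : InDcl L (Sum.elim c fun _ : Unit => a) u) (k : κ)
    (huu : (ε k).Realize ![u, u]) : ∃ l, (ε k).Realize ![u, c l] := by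
  obtain ⟨E, hE⟩ := hu.exists_image ((ε k).relabel ![Sum.inl (Sum.inr ()), Sum.inr ()])
  simp only [Formula.realize_relabel, comp_vec_two, Sum.elim_inl, Sum.elim_inr] at hE
  -- The definition of the class of u uses finitely many witnesses, so it is itself the index of a
  -- `lift` variable.
  obtain ⟨n, args, E', hE'⟩ := exists_finite_variables (M := U)
    (E.relabel (Equiv.sumAssoc (WitnessVar L κ q) Unit Unit))
  let E'' : L.Formula ((Fin n ⊕ Unit) ⊕ Unit) := E'.relabel (Equiv.sumAssoc (Fin n) Unit Unit).symm
  have hE'' : ∀ z, E''.Realize (Sum.elim (Sum.elim (c ∘ args) fun _ => a) fun _ => z) ↔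
      (ε k).Realize ![u, z] := by
    intro z
    rw [← hE z]
    have h1 := hE' c (Sum.elim (fun _ => a) fun _ => z)
    rw [Formula.realize_relabel] at h1 ⊢
    have e1 : Sum.elim c (Sum.elim (fun _ => a) fun _ => z) ∘
        Equiv.sumAssoc (WitnessVar L κ q) Unit Unit =
        Sum.elim (Sum.elim c fun _ => a) fun _ => z := by
      funext k; rcases k with (k | k) | k <;> rfl
    have e2 : (Sum.elim (Sum.elim (c ∘ args) fun _ => a) fun _ => z) ∘
        (Equiv.sumAssoc (Fin n) Unit Unit).symm =
        Sum.elim (c ∘ args) (Sum.elim (fun _ => a) fun _ => z) := by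
      funext k; rcases k with k | (k | k) <;> rfl
    rw [e1] at h1
    rw [e2, h1]
  exact ⟨.lift k n E'' args, (hE'' _).1 (evalAt_ax_lift.1 (hax _) ⟨u, huu, hE''⟩)⟩

/-- If the conditions on witness variables hold, the witnesses form an elementary
substructure. -/
theorem exists_elementarySubstructure_range {κ : Type} {q : ℕ} {ε : κ → L.Formula (Fin 2)}
    {c : WitnessVar L κ q → U} {a : U} (hax : ∀ l : WitnessVar L κ q, evalAt (l.ax ε) a c) :
    ∃ K : L.ElementarySubstructure U, (K : Set U) = Set.range c := by
  -- This is the Tarski–Vaught criterion; closure under functions is the case where E is the graph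
  -- of the function.
  have hwit : ∀ (n : ℕ) (E : L.Formula (Fin n ⊕ Unit)) (y : Fin n → U),
      (∀ i, y i ∈ Set.range c) → (∃ z, E.Realize (Sum.elim y fun _ => z)) →
      ∃ l, E.Realize (Sum.elim y fun _ => c l) := by
    intro n E y hy hz
    choose args hargs using hy
    obtain rfl : c ∘ args = y := funext hargs
    exact ⟨.wit n E args, evalAt_ax_wit.1 (hax _) hz⟩
  let S : L.Substructure U :=
    { carrier := Set.range c
      fun_mem := by
        intro n f y hy
        obtain ⟨l, hl⟩ := hwit n
          ((Term.func f fun i => Term.var (Sum.inl i)).equal (Term.var (Sum.inr ()))) y hy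
          ⟨Structure.funMap f y, by simp [Formula.realize_equal]⟩
        exact ⟨l, by simpa [Formula.realize_equal] using hl.symm⟩ }
  refine ⟨S.toElementarySubstructure ?_, rfl⟩
  intro n φ x b hb
  let E : L.Formula (Fin n ⊕ Unit) := φ.toFormula.relabel
    (Sum.elim Empty.elim (Fin.snoc Sum.inl (Sum.inr ())))
  have hE : ∀ z, E.Realize (Sum.elim (fun i => (x i : U)) fun _ => z) ↔
      φ.Realize default (Fin.snoc ((↑) ∘ x) z : Fin (n + 1) → U) := by
    intro z
    rw [Formula.realize_relabel, BoundedFormula.realize_toFormula]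
    refine Iff.of_eq (congrArg₂ _ (Subsingleton.elim _ _) ?_)
    funext k
    refine Fin.lastCases ?_ (fun k => ?_) k <;> simp
  obtain ⟨l, hl⟩ := hwit n E (fun i => x i) (fun i => (x i).2) ⟨b, (hE b).2 hb⟩
  exact ⟨⟨c l, l, rfl⟩, (hE _).1 hl⟩

end DefinableElements

/-! ### Definability in valued fields -/

section ValuedFields

variable {L : FirstOrder.Language.{u, v}} (σ : ValuedFieldLanguage L)

/-- The term `s + t`. -/
def ValuedFieldLanguage.addTerm {α : Type*} (s t : L.Term α) : L.Term α :=
  (σ.ring.onFunction Ring.addFunc).apply₂ s t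

/-- The term `s * t`. -/
def ValuedFieldLanguage.mulTerm {α : Type*} (s t : L.Term α) : L.Term α :=
  (σ.ring.onFunction Ring.mulFunc).apply₂ s t

/-- The term `-t`. -/
def ValuedFieldLanguage.negTerm {α : Type*} (t : L.Term α) : L.Term α :=
  (σ.ring.onFunction Ring.negFunc).apply₁ t

/-- The term `0`. -/
def ValuedFieldLanguage.zeroTerm {α : Type*} : L.Term α :=
  Term.func (σ.ring.onFunction Ring.zeroFunc) ![]

/-- The term `1`. -/
def ValuedFieldLanguage.oneTerm {α : Type*} : L.Term α :=
  Term.func (σ.ring.onFunction Ring.oneFunc) ![]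

/-- The formula that expresses that two elements of the valuation ring have the same residue. -/
noncomputable def ValuedFieldLanguage.residueFormula : L.Formula (Fin 2) :=
  σ.valRing.formula₁ (Term.var 0) ⊓ (σ.valRing.formula₁ (Term.var 1) ⊓
    ((σ.valRing.formula₁ (Term.var (Sum.inr ())) ⊓
      (σ.mulTerm (σ.addTerm (Term.var (Sum.inl 0)) (σ.negTerm (Term.var (Sum.inl 1))))
        (Term.var (Sum.inr ()))).equal σ.oneTerm : L.Formula (Fin 2 ⊕ Unit)).iExs Unit).not)

/-- The formula that expresses that two nonzero elements have the same value. -/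
noncomputable def ValuedFieldLanguage.valueFormula : L.Formula (Fin 2) :=
  ((Term.var 0).equal σ.zeroTerm).not ⊓ (((Term.var 1).equal σ.zeroTerm).not ⊓
    ((σ.valRing.formula₁ (Term.var (Sum.inr 0)) ⊓ (σ.valRing.formula₁ (Term.var (Sum.inr 1)) ⊓
      ((Term.var (Sum.inl 0)).equal
        (σ.mulTerm (Term.var (Sum.inr 0)) (Term.var (Sum.inl 1))) ⊓
      (Term.var (Sum.inl 1)).equal
        (σ.mulTerm (Term.var (Sum.inr 1)) (Term.var (Sum.inl 0))))) :
          L.Formula (Fin 2 ⊕ Fin 2)).iExs (Fin 2)))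

variable {σ} {K : Type w} [L.Structure K] [Field K] {A : ValuationSubring K}
  (h : IsValuedField σ K A)

include h

section Terms

variable {α : Type*} (s t : L.Term α) (x : α → K)

theorem IsValuedField.realize_addTerm :
    (σ.addTerm s t).realize x = s.realize x + t.realize x := by
  rw [ValuedFieldLanguage.addTerm, Term.realize_functions_apply₂, h.add]

theorem IsValuedField.realize_mulTerm :
    (σ.mulTerm s t).realize x = s.realize x * t.realize x := by
  rw [ValuedFieldLanguage.mulTerm, Term.realize_functions_apply₂, h.mul]

theorem IsValuedField.realize_negTerm : (σ.negTerm t).realize x = -t.realize x := by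
  rw [ValuedFieldLanguage.negTerm, Term.realize_functions_apply₁, h.neg]

theorem IsValuedField.realize_zeroTerm : (σ.zeroTerm : L.Term α).realize x = 0 := by
  rw [ValuedFieldLanguage.zeroTerm, Term.realize_func, ← h.zero]
  exact congrArg _ (Subsingleton.elim _ _)

theorem IsValuedField.realize_oneTerm : (σ.oneTerm : L.Term α).realize x = 1 := by
  rw [ValuedFieldLanguage.oneTerm, Term.realize_func, ← h.one]
  exact congrArg _ (Subsingleton.elim _ _)

end Terms

theorem IsValuedField.realize_residueFormula (z z' : K) :
    σ.residueFormula.Realize ![z, z'] ↔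
      ∃ (hz : z ∈ (A : Set K)) (hz' : z' ∈ (A : Set K)),
        residueMap A ⟨z, hz⟩ = residueMap A ⟨z', hz'⟩ := by
  simp only [ValuedFieldLanguage.residueFormula, Formula.realize_inf, Formula.realize_rel₁,
    Formula.realize_not, Formula.realize_iExs, Formula.realize_equal, h.mem, Term.realize_var,
    h.realize_mulTerm, h.realize_addTerm, h.realize_negTerm, h.realize_oneTerm,
    Sum.elim_inl, Sum.elim_inr, Matrix.cons_val_zero, Matrix.cons_val_one]
  rw [← exists_prop]
  refine exists_congr fun hz => ?_
  rw [← exists_prop]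
  refine exists_congr fun hz' => ?_
  let x : A := ⟨z, hz⟩
  let y : A := ⟨z', hz'⟩
  change _ ↔ IsLocalRing.residue A x = IsLocalRing.residue A y
  rw [← sub_eq_zero, ← map_sub, IsLocalRing.residue_eq_zero_iff, IsLocalRing.mem_maximalIdeal,
    mem_nonunits_iff, isUnit_iff_exists_inv]
  refine not_congr ⟨?_, ?_⟩
  · rintro ⟨w, hw, e⟩
    refine ⟨⟨w (), hw⟩, Subtype.ext ?_⟩
    simpa [sub_eq_add_neg] using e
  · rintro ⟨w, e⟩
    refine ⟨fun _ => w, w.2, ?_⟩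
    simpa [sub_eq_add_neg] using congrArg Subtype.val e

theorem IsValuedField.realize_valueFormula (z z' : K) :
    σ.valueFormula.Realize ![z, z'] ↔
      ∃ (hz : z ∈ {x : K | x ≠ 0}) (hz' : z' ∈ {x : K | x ≠ 0}),
        valueMap A ⟨z, hz⟩ = valueMap A ⟨z', hz'⟩ := by
  simp only [ValuedFieldLanguage.valueFormula, Formula.realize_inf, Formula.realize_rel₁,
    Formula.realize_not, Formula.realize_iExs, Formula.realize_equal, h.mem, Term.realize_var,
    h.realize_mulTerm, h.realize_zeroTerm,
    Sum.elim_inl, Sum.elim_inr, Matrix.cons_val_zero, Matrix.cons_val_one]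
  rw [← exists_prop]
  refine exists_congr fun hz => ?_
  rw [← exists_prop]
  refine exists_congr fun hz' => ?_
  rw [valueMap, valueMap, Units.mk0_inj]
  constructor
  · rintro ⟨w, h0, h1, e0, e1⟩
    have key : ∀ (x y u : K), u ∈ A → x = u * y → A.valuation x ≤ A.valuation y := by
      rintro x y u hu rfl
      rw [map_mul]
      exact mul_le_of_le_one_left' ((A.valuation_le_one_iff u).2 hu)
    exact le_antisymm (key _ _ _ h0 e0) (key _ _ _ h1 e1)
  · intro e
    have hv : A.valuation z' ≠ 0 := (Valuation.ne_zero_iff _).2 hz'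
    refine ⟨![z / z', z' / z], ?_, ?_, ?_, ?_⟩
    · rw [← A.valuation_le_one_iff]
      simp [map_div₀, e, hv]
    · rw [← A.valuation_le_one_iff]
      simp [map_div₀, e, hv]
    · simp [div_mul_cancel₀ z hz']
    · simp [div_mul_cancel₀ z' hz]

/-- The elements of the subfield generated by a set are definable from its elements. -/
theorem IsValuedField.inDcl_of_mem_closure {α : Type*} (x : α → K) (i₀ : α) {y : K}
    (hy : y ∈ Subfield.closure (Set.range x)) : InDcl L x y := by
  let X : Fin 3 → L.Term (Fin 3) := Term.var
  induction hy using Subfield.closure_induction with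
  | mem y hy =>
    obtain ⟨i, rfl⟩ := hy
    exact inDcl_apply x i
  | one =>
    refine (inDcl_apply x i₀).map₂ (inDcl_apply x i₀) ((X 2).equal σ.oneTerm) fun z => ?_
    simp [X, Formula.realize_equal, h.realize_oneTerm]
  | add y z _ _ hy hz =>
    refine hy.map₂ hz ((X 2).equal (σ.addTerm (X 0) (X 1))) fun z => ?_
    simp [X, Formula.realize_equal, h.realize_addTerm]
  | neg y _ hy =>
    refine hy.map₂ hy ((X 2).equal (σ.negTerm (X 0))) fun z => ?_
    simp [X, Formula.realize_equal, h.realize_negTerm]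
  | inv y _ hy =>
    -- Unlike y * z = 1, the equations y²z = y and z²y = z also determine 0⁻¹ = 0.
    refine hy.map₂ hy ((σ.mulTerm (X 0) (σ.mulTerm (X 0) (X 2))).equal (X 0) ⊓
      (σ.mulTerm (X 2) (σ.mulTerm (X 2) (X 0))).equal (X 2)) fun z => ?_
    simp only [X, Formula.realize_inf, Formula.realize_equal, h.realize_mulTerm, Term.realize_var]
    change y * (y * z) = y ∧ z * (z * y) = z ↔ z = y⁻¹
    constructor
    · rintro ⟨h1, h2⟩
      by_cases hy0 : y = 0
      · subst hy0; simpa using h2.symm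
      · have : y * z = 1 := by
          apply mul_left_cancel₀ hy0
          rw [h1, mul_one]
        exact eq_inv_of_mul_eq_one_right this
    · rintro rfl
      by_cases hy0 : y = 0
      · simp [hy0]
      · simp [hy0]
  | mul y z _ _ hy hz =>
    refine hy.map₂ hz ((X 2).equal (σ.mulTerm (X 0) (X 1))) fun z => ?_
    simp [X, Formula.realize_equal, h.realize_mulTerm]

end ValuedFields

/-! ### From the sorts to the theory -/

section Transfer

variable {L : FirstOrder.Language.{u, v}}

/-- An instance of a formula that is NIP modulo the theory of `M`, with witness variables as
parameters. -/
structure NIPInstance (M : Type w) [L.Structure M] (Λ : Type (max u v)) where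
  arity : ℕ
  formula : L.Formula (Fin 1 ⊕ Fin arity)
  isNIP : IsNIPFormula (L.completeTheory M) formula
  param : Fin arity → Λ

/-- If `φ(x; y)` shatters arbitrarily large families in `M`, there are an elementarily equivalent
structure, witnesses `c`, and two elements that are distinguished by `φ` over the base witnesses
but not by formulas that are NIP. -/
theorem exists_indistinguishable {κ : Type} {q : ℕ} {ε : κ → L.Formula (Fin 2)}
    {M : Type (max u v)} [L.Structure M] [Nonempty M] (hε : ∀ k, PresentsNIPSort M (ε k))
    {φ : L.Formula (Fin 1 ⊕ Fin q)} (hφ : ∀ n, Shatters φ M n) :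
    ∃ (U : Type (max u v)) (_ : L.Structure U) (_ : Nonempty U)
      (c : WitnessVar L κ q → U) (a a' : U),
      L.completeTheory U = L.completeTheory M ∧ (∀ l, evalAt (WitnessVar.ax ε l) a c) ∧
      evalAt (onBase φ) a c ∧ ¬ evalAt (onBase φ) a' c ∧
      ∀ i : NIPInstance (L := L) M (WitnessVar L κ q),
        i.formula.Realize (Sum.elim (fun _ => a) (c ∘ i.param)) ↔
          i.formula.Realize (Sum.elim (fun _ => a') (c ∘ i.param)) := by
  classical
  let Λ := WitnessVar L κ q
  -- The unknowns for compactness are the witnesses together with a, named by `true`, and a', named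
  -- by `false`.
  let left : Λ ⊕ Unit → Λ ⊕ Bool := Sum.map id fun _ => true
  let right : Λ ⊕ Unit → Λ ⊕ Bool := Sum.map id fun _ => false
  have hleft : ∀ {N : Type (max u v)} [L.Structure N] (ψ : L.Formula (Λ ⊕ Unit))
      (x : Λ ⊕ Bool → N), (ψ.relabel left).Realize x ↔
        evalAt ψ (x (Sum.inr true)) (x ∘ Sum.inl) := fun ψ x =>
    Formula.realize_relabel.trans (Iff.of_eq (congrArg _ (by funext k; cases k <;> rfl)))
  have hright : ∀ {N : Type (max u v)} [L.Structure N] (ψ : L.Formula (Λ ⊕ Unit))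
      (x : Λ ⊕ Bool → N), (ψ.relabel right).Realize x ↔
        evalAt ψ (x (Sum.inr false)) (x ∘ Sum.inl) := fun ψ x =>
    Formula.realize_relabel.trans (Iff.of_eq (congrArg _ (by funext k; cases k <;> rfl)))
  let inst : NIPInstance (L := L) M Λ → L.Formula (Λ ⊕ Unit) := fun i =>
    i.formula.relabel (Sum.elim (fun _ => Sum.inr ()) fun j => Sum.inl (i.param j))
  have hinst : ∀ {N : Type (max u v)} [L.Structure N] (i) (x : N) (c : Λ → N),
      evalAt (inst i) x c ↔ i.formula.Realize (Sum.elim (fun _ => x) (c ∘ i.param)) :=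
    fun i x c => Formula.realize_relabel.trans
      (Iff.of_eq (congrArg _ (by funext k; cases k <;> rfl)))
  let γ : Option (Λ ⊕ NIPInstance (L := L) M Λ) → L.Formula (Λ ⊕ Bool) := fun j => match j with
    | none => (onBase φ).relabel left ⊓ ((onBase φ).relabel right).not
    | some (Sum.inl l) => (l.ax ε).relabel left
    | some (Sum.inr i) => ((inst i).relabel left).iff ((inst i).relabel right)
  obtain ⟨U, hstr, hne, hU, x, hx⟩ := exists_realize_of_finitely (M := M) γ (by
    intro s
    let F : Finset Λ := s.preimage (fun l => some (Sum.inl l)) fun l _ l' _ e =>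
      Sum.inl_injective (Option.some_injective _ e)
    let I : Finset (NIPInstance (L := L) M Λ) := s.preimage (fun i => some (Sum.inr i))
      fun l _ l' _ e => Sum.inr_injective (Option.some_injective _ e)
    obtain ⟨a, a', c, ⟨ha, haF⟩, ha', hI⟩ :=
      (patterns_with_witnesses hε hφ F).exists_agree
        (fun (i : I) (x : M) (c : Λ → M) => evalAt (inst i.1) x c) (by
          rintro ⟨i, -⟩
          obtain ⟨m, hm⟩ := i.isNIP
          have hmod : M ⊨ L.completeTheory M := inferInstance
          refine ⟨m, ?_⟩
          rintro ⟨a, b, hab⟩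
          exact @hm M _ _ hmod ⟨fun k _ => a k, fun S => b S ∘ i.param,
            fun k S => (hinst i _ _).symm.trans (hab k S)⟩)
    refine ⟨Sum.elim c fun b => if b then a else a', ?_⟩
    rintro (_ | l | i) hj
    · refine Formula.realize_inf.2 ⟨(hleft _ _).2 ha, Formula.realize_not.2 ?_⟩
      exact fun h => ha' ((hright _ _).1 h)
    · exact (hleft _ _).2 (haF l (Finset.mem_preimage.2 hj))
    · refine Formula.realize_iff.2 ((hleft _ _).trans (Iff.trans ?_ (hright _ _).symm))
      exact hI ⟨i, Finset.mem_preimage.2 hj⟩)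
  have h0 := Formula.realize_inf.1 (hx none)
  refine ⟨U, hstr, hne, x ∘ Sum.inl, x (Sum.inr true), x (Sum.inr false), hU,
    fun l => (hleft _ _).1 (hx (some (Sum.inl l))), (hleft _ _).1 h0.1,
    fun h => Formula.realize_not.1 h0.2 ((hright _ _).2 h), fun i => ?_⟩
  rw [← hinst, ← hinst, ← hleft, ← hright]
  exact Formula.realize_iff.1 (hx (some (Sum.inr i)))

variable {σ : ValuedFieldLanguage L} {T : L.Theory}

theorem valueMap_surjective {K : Type w} [Field K] (A : ValuationSubring K) :
    Function.Surjective (valueMap A) := by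
  intro g
  obtain ⟨x, hx⟩ := A.valuation_surjective (g : A.ValueGroup)
  have hx0 : x ≠ 0 := by
    rintro rfl
    rw [map_zero] at hx
    exact g.ne_zero hx.symm
  exact ⟨⟨x, hx0⟩, Units.ext hx⟩

theorem residueMap_surjective {K : Type w} [Field K] (A : ValuationSubring K) :
    Function.Surjective (residueMap A) := by
  intro r
  obtain ⟨x, hx⟩ := IsLocalRing.residue_surjective r
  exact ⟨⟨x.1, x.2⟩, hx⟩

theorem isNIPTheory_of_sorts (hT : IsValuedFieldTheory σ T) (hSE : CondSE σ T)
    (hIm : CondIm σ T) (hR : ResidueFieldNIP σ T) (hV : ValueGroupNIP σ T) : IsNIPTheory T := by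
  intro p q φ
  by_contra hφ
  obtain ⟨M, _, _, _, hM⟩ := exists_model_forall_shatters hφ
  obtain ⟨q, φ, hφ⟩ : ∃ (q : ℕ) (φ : L.Formula (Fin 1 ⊕ Fin q)), ∀ n, Shatters φ M n := by
    by_contra! hcon
    exact not_patterns_of_single_variable hcon p q φ (patterns_of_shatters hM)
  obtain ⟨_, A, hA⟩ := hT M
  let ε : Bool → L.Formula (Fin 2) := fun b => if b then σ.residueFormula else σ.valueFormula
  have hε : ∀ k, PresentsNIPSort M (ε k) := by
    rintro (_ | _)
    · exact ⟨(A.ValueGroup)ˣ, inferInstance, _, valueMap A, valueMap_surjective A,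
        hA.realize_valueFormula, (hSE M A hA).2, hV M A hA⟩
    · exact ⟨IsLocalRing.ResidueField A, inferInstance, _, residueMap A, residueMap_surjective A,
        hA.realize_residueFormula, (hSE M A hA).1, hR M A hA⟩
  obtain ⟨U, _, _, c, a, a', hU, hax, ha, ha', hNIP⟩ := exists_indistinguishable hε hφ
  have hUT : U ⊨ T := ⟨fun ψ hψ => by
    have : ψ ∈ L.completeTheory M := Theory.realize_sentence_of_mem T hψ
    rw [← hU] at this
    exact this⟩
  obtain ⟨_, B, hB⟩ := hT U
  obtain ⟨K, hK⟩ := exists_elementarySubstructure_range hax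
  have hcK : ∀ l, c l ∈ (K : Set U) := fun l => hK ▸ Set.mem_range_self l
  -- Every element of K(a) is definable from c and a, so its residue and its value are already
  -- represented by some `c l` in K. This gives immediacy.
  have hlift : ∀ u ∈ Subfield.closure (insert a (K : Set U)), ∀ k, (ε k).Realize ![u, u] →
      ∃ l, (ε k).Realize ![u, c l] := by
    intro u hu k huu
    refine exists_lift_of_inDcl hax
      (hB.inDcl_of_mem_closure (Sum.elim c fun _ : Unit => a) (Sum.inr ()) ?_) k huu
    rw [Set.Sum.elim_range, Set.range_const, ← hK, Set.union_singleton]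
    exact hu
  have hsub : Subfield.closure (K : Set U) ≤ Subfield.closure (insert a (K : Set U)) :=
    Subfield.closure_mono (Set.subset_insert _ _)
  have himm : IsImmediate B (Subfield.closure (K : Set U))
      (Subfield.closure (insert a (K : Set U))) := by
    refine ⟨hsub, Set.Subset.antisymm ?_ ?_, Set.Subset.antisymm ?_ ?_⟩
    · rintro _ ⟨u, hu, rfl⟩
      by_cases hu0 : u = 0
      · exact ⟨0, zero_mem _, by rw [hu0]⟩
      · obtain ⟨l, hl⟩ := hlift u hu false ((hB.realize_valueFormula u u).2 ⟨hu0, hu0, rfl⟩)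
        obtain ⟨h1, h2, h3⟩ := (hB.realize_valueFormula _ _).1 hl
        exact ⟨c l, Subfield.subset_closure (hcK l), (Units.mk0_inj _ _).1 h3.symm⟩
    · rintro _ ⟨u, hu, rfl⟩
      exact ⟨u, hsub hu, rfl⟩
    · rintro _ ⟨u, hu, rfl⟩
      obtain ⟨l, hl⟩ := hlift u hu true ((hB.realize_residueFormula u u).2 ⟨u.2, u.2, rfl⟩)
      obtain ⟨h1, h2, h3⟩ := (hB.realize_residueFormula _ _).1 hl
      exact ⟨⟨c l, h2⟩, Subfield.subset_closure (hcK l), h3.symm⟩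
    · rintro _ ⟨u, hu, rfl⟩
      exact ⟨u, hsub hu, rfl⟩
  -- The instance of φ in tp(a/K) follows from NIP instances true of a. These hold of a' as well, so
  -- φ is forced on a'.
  obtain ⟨P₀, hP₀, -, himp⟩ := hIm U B hB K a himm
    ⟨q, φ, fun j => ⟨c (.base j), hcK _⟩⟩ ((evalAt_onBase φ a c).1 ha)
  refine ha' ((evalAt_onBase φ a' c).2 (himp a' fun χ hχ => ?_))
  obtain ⟨h1, h2⟩ := hP₀ hχ
  have hpar : ∀ j, ∃ l, c l = χ.param j := fun j => hK.subset (χ.param j).2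
  choose l hl using hpar
  have := hNIP ⟨χ.arity, χ.formula, hU ▸ h2, l⟩
  have e : c ∘ l = fun j => (χ.param j : U) := funext hl
  simp only [e] at this
  exact this.1 h1

end Transfer

/-! ### From the theory to the sorts -/

section Induced

/-- Since shattering n tuples is a first-order property, it can be tested on D itself instead of on
all models of its complete theory. -/
theorem exists_sentence_shatters {L : FirstOrder.Language.{u, v}} {p q : ℕ}
    (φ : L.Formula (Fin p ⊕ Fin q)) (n : ℕ) :
    ∃ ψ : L.Sentence, ∀ (M : Type w) [L.Structure M], M ⊨ ψ ↔ Shatters φ M n := by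
  classical
  let γ := (Fin n × Fin p) ⊕ (Set (Fin n) × Fin q)
  let χ : Fin n × Set (Fin n) → L.Formula (Empty ⊕ γ) := fun k =>
    φ.relabel (Sum.inr ∘ Sum.map (fun j => (k.1, j)) fun j => (k.2, j))
  let θ : Fin n × Set (Fin n) → L.Formula (Empty ⊕ γ) := fun k =>
    if k.1 ∈ k.2 then χ k else (χ k).not
  refine ⟨Formula.iExs γ (BoundedFormula.iInf θ), fun M _ => ?_⟩
  refine Formula.realize_iExs.trans ?_
  have key : ∀ (x : γ → M) (y : Empty → M),
      Formula.Realize (BoundedFormula.iInf θ) (Sum.elim y x) ↔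
      ∀ i S, φ.Realize (Sum.elim (fun j => x (Sum.inl (i, j))) fun j => x (Sum.inr (S, j))) ↔
        i ∈ S := by
    intro x y
    refine BoundedFormula.realize_iInf.trans (Prod.forall.trans (forall₂_congr fun i S => ?_))
    have hχ : (χ (i, S)).Realize (Sum.elim y x) ↔
        φ.Realize (Sum.elim (fun j => x (Sum.inl (i, j))) fun j => x (Sum.inr (S, j))) :=
      Formula.realize_relabel.trans (Iff.of_eq (congrArg _ (by funext k; cases k <;> rfl)))
    rw [← hχ]
    by_cases hi : i ∈ S
    · simp only [θ, hi, if_true, iff_true]; rfl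
    · simp only [θ, hi, if_false, iff_false]; rfl
  constructor
  · rintro ⟨x, hx⟩
    exact ⟨_, _, (key _ _).1 hx⟩
  · rintro ⟨a, b, hab⟩
    exact ⟨Sum.elim (fun k => a k.1 k.2) fun k => b k.1 k.2, (key _ _).2 hab⟩

variable {L : FirstOrder.Language.{u, v}} {K : Type w} [L.Structure K] {D : Type w'} {X : Set K}
  {π : X → D} {ε : L.Formula (Fin 2)}

/-- Formulas of the induced structure are definable in the ambient structure. -/
theorem exists_formula_of_induced (hπ : Function.Surjective π)
    (hε : ∀ z z', ε.Realize ![z, z'] ↔ ∃ (h : z ∈ X) (h' : z' ∈ X), π ⟨z, h⟩ = π ⟨z', h'⟩)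
    {α : Type*} {n : ℕ} (Φ : (inducedLanguage L).BoundedFormula α n) :
    letI := inducedStructure L π
    ∃ ψ : L.Formula (α ⊕ Fin n), ∀ (y : α → X) (z : Fin n → X),
      ψ.Realize (fun i => ((Sum.elim y z i : X) : K)) ↔ Φ.Realize (π ∘ y) (π ∘ z) := by
  let _ := inducedStructure L π
  have hvar : ∀ {β : Type _} (t : (inducedLanguage L).Term β), ∃ i, t = Term.var i := by
    rintro β (i | ⟨f, _⟩)
    · exact ⟨i, rfl⟩
    · exact f.elim
  have hcomp : ∀ {n : ℕ} (y : α → X) (z : Fin n → X),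
      Sum.elim (π ∘ y) (π ∘ z) = π ∘ Sum.elim y z := fun y z => (Sum.comp_elim π y z).symm
  have hεX : ∀ x y : X, ε.Realize ![(x : K), y] ↔ π x = π y := fun x y =>
    (hε _ _).trans ⟨fun ⟨_, _, h⟩ => h, fun h => ⟨x.2, y.2, h⟩⟩
  induction Φ with
  | falsum => exact ⟨⊥, fun y z => Iff.rfl⟩
  | equal t₁ t₂ =>
    obtain ⟨i, rfl⟩ := hvar t₁
    obtain ⟨j, rfl⟩ := hvar t₂
    -- The induced language has no function symbols, so terms are variables, and equality in D is ε
    -- on representatives.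
    refine ⟨ε.relabel ![i, j], fun y z => ?_⟩
    rw [Formula.realize_relabel, comp_vec_two, hεX, BoundedFormula.Realize, hcomp]
    rfl
  | @rel n m R ts =>
    choose i hi using fun k => hvar (ts k)
    -- An induced relation holds of classes as soon as some representatives satisfy R; hence the
    -- quantifier over w, even when a variable is repeated.
    obtain ⟨ψ, hψ⟩ : IsDef L fun v : α ⊕ Fin n → K => ∃ w : Fin m → K,
        (∀ k, ε.Realize ![w k, v (i k)]) ∧ Formula.Realize (L := L) R w := by
      refine IsDef.exists_tuple (P := fun (v : α ⊕ Fin n → K) (w : Fin m → K) =>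
        (∀ k, ε.Realize ![w k, v (i k)]) ∧ Formula.Realize (L := L) R w) ?_
      refine (IsDef.all_finite fun k => ?_).and ((isDef_realize _).comp Sum.inr)
      exact ((isDef_realize ε).comp ![Sum.inr k, Sum.inl (i k)]).congr fun v => by
        rw [comp_vec_two]; rfl
    refine ⟨ψ, fun y z => (hψ _).trans ?_⟩
    rw [BoundedFormula.Realize, hcomp]
    have e : (fun k => (ts k).realize (π ∘ Sum.elim y z)) = fun k => π (Sum.elim y z (i k)) := by
      funext k; rw [hi k]; rfl
    rw [e]
    constructor
    · rintro ⟨w, hw, hR⟩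
      refine ⟨fun k => ⟨w k, ((hε _ _).1 (hw k)).1⟩, fun k => ?_, hR⟩
      exact ((hε _ _).1 (hw k)).2.2
    · rintro ⟨w, hw, hR⟩
      exact ⟨fun k => w k, fun k => (hεX _ _).2 (hw k), hR⟩
  | imp Φ₁ Φ₂ ih₁ ih₂ =>
    obtain ⟨ψ₁, hψ₁⟩ := ih₁
    obtain ⟨ψ₂, hψ₂⟩ := ih₂
    exact ⟨ψ₁.imp ψ₂, fun y z => Formula.realize_imp.trans (imp_congr (hψ₁ y z) (hψ₂ y z))⟩
  | @all n Φ ih =>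
    obtain ⟨ψ, hψ⟩ := ih
    -- The condition ε(x, x) defines X, and as π is surjective, quantifying over X amounts to
    -- quantifying over D.
    obtain ⟨ψ', hψ'⟩ : IsDef L fun v : α ⊕ Fin n → K => ∀ x, ε.Realize ![x, x] →
        ψ.Realize (Sum.elim (v ∘ Sum.inl) (Fin.snoc (v ∘ Sum.inr) x : Fin (n + 1) → K)) := by
      refine IsDef.forall (P := fun (v : α ⊕ Fin n → K) x => ε.Realize ![x, x] →
        ψ.Realize (Sum.elim (v ∘ Sum.inl) (Fin.snoc (v ∘ Sum.inr) x : Fin (n + 1) → K))) ?_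
      refine IsDef.imp ?_ ?_
      · exact ((isDef_realize ε).comp ![Sum.inr (), Sum.inr ()]).congr fun v => by
          rw [comp_vec_two]
      · refine ((isDef_realize ψ).comp (Sum.elim (Sum.inl ∘ Sum.inl)
          (Fin.snoc (Sum.inl ∘ Sum.inr) (Sum.inr ())))).congr fun v =>
          Iff.of_eq (congrArg _ ?_)
        funext k
        rcases k with k | k
        · rfl
        · refine Fin.lastCases ?_ (fun k => ?_) k <;> simp
    refine ⟨ψ', fun y z => (hψ' _).trans ?_⟩
    rw [BoundedFormula.realize_all]
    have key : ∀ x : X, ψ.Realize (Sum.elim ((fun i => ((Sum.elim y z i : X) : K)) ∘ Sum.inl)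
        (Fin.snoc ((fun i => ((Sum.elim y z i : X) : K)) ∘ Sum.inr) (x : K) : Fin (n + 1) → K)) ↔
        Φ.Realize (π ∘ y) (Fin.snoc (π ∘ z) (π x)) := by
      intro x
      have h1 := hψ y (Fin.snoc z x)
      rw [Fin.comp_snoc] at h1
      rw [← h1]
      refine Iff.of_eq (congrArg _ ?_)
      funext k
      rcases k with k | k
      · rfl
      · refine Fin.lastCases ?_ (fun k => ?_) k <;> simp
    constructor
    · intro h d
      obtain ⟨x, rfl⟩ := hπ d
      exact (key x).1 (h x ((hεX x x).2 rfl))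
    · intro h x hx
      exact (key ⟨x, ((hε _ _).1 hx).1⟩).2 (h _)

end Induced

section InducedNIP

variable {L : FirstOrder.Language.{u, v}}

/-- The structure induced on a sort of a model of a NIP theory is NIP. -/
theorem IsNIPTheory.induced {T : L.Theory} (hT : IsNIPTheory T) {K : Type (max u v)}
    [L.Structure K] [Nonempty K] [T.Model K] {D : Type (max u v)} {X : Set K} {π : X → D}
    {ε : L.Formula (Fin 2)} (hπ : Function.Surjective π)
    (hε : ∀ z z', ε.Realize ![z, z'] ↔ ∃ (h : z ∈ X) (h' : z' ∈ X), π ⟨z, h⟩ = π ⟨z', h'⟩) :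
    IsNIPTheory (inducedTheory L π) := by
  intro p q Φ
  let _ := inducedStructure L π
  obtain ⟨ψ, hψ⟩ := exists_formula_of_induced hπ hε Φ
  obtain ⟨n, hn⟩ := hT p q (ψ.relabel (Sum.elim id Fin.elim0))
  obtain ⟨s, hs⟩ := exists_sentence_shatters.{0, max u v, max u v} Φ n
  refine ⟨n, fun D' _ _ hD' hsh => hn K ?_⟩
  have hD : Shatters Φ D n := by
    rw [← hs]
    by_contra hns
    have : s.not ∈ inducedTheory L π := hns
    exact hD'.realize_of_mem _ this ((hs D').2 hsh)
  obtain ⟨a, b, hab⟩ := hD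
  choose r hr using hπ
  refine ⟨fun i j => r (a i j), fun S j => r (b S j), fun i S => ?_⟩
  rw [← hab i S, Formula.realize_relabel]
  have h1 := hψ (r ∘ Sum.elim (a i) (b S)) Fin.elim0
  have e : π ∘ r ∘ Sum.elim (a i) (b S) = Sum.elim (a i) (b S) := funext fun k => hr _
  rw [e] at h1
  refine Iff.trans (Iff.of_eq (congrArg _ ?_)) (h1.trans
    (Formula.boundedFormula_realize_eq_realize _ _ _))
  funext k
  rcases k with (k | k) | k
  · rfl
  · rfl
  · exact k.elim0

end InducedNIP

end NIPTransfer

theorem theorem2p3 {L : FirstOrder.Language.{u, v}} (σ : NIPTransfer.ValuedFieldLanguage L) (T : L.Theory)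
    (hT : NIPTransfer.IsValuedFieldTheory σ T)
    (hSE : NIPTransfer.CondSE σ T) (hIm : NIPTransfer.CondIm σ T) :
    NIPTransfer.IsNIPTheory T ↔
      NIPTransfer.ResidueFieldNIP σ T ∧ NIPTransfer.ValueGroupNIP σ T := by
  refine ⟨fun h => ⟨fun K _ _ _ A hA => ?_, fun K _ _ _ A hA => ?_⟩,
    fun h => NIPTransfer.isNIPTheory_of_sorts hT hSE hIm h.1 h.2⟩
  · exact h.induced (NIPTransfer.residueMap_surjective A) hA.realize_residueFormula
  · exact h.induced (NIPTransfer.valueMap_surjective A) hA.realize_valueFormula
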